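/- Let $D\subset\mathbb{C}^n$ be a bounded homogeneous domain, i.e. a bounded connected open set on which the group of biholomorphic self-maps acts transitively, and assume $0\in D$. Let $H_z$ be the Bergman metric of $D$, $$H_z(u,\overline v)=\sum_{j,k=1}^n\frac{\partial^2\log K(z,z)}{\partial z_j\,\partial\overline{z_k}}\,u_j\overline{v_k},$$ where $K$ is the Bergman kernel of $D$. For a holomorphic function $f:D\to\mathbb{C}$ put $$\beta_f=\sup_{z\in D}\ \sup_{u\in\mathbb{C}^n\setminus\{0\}}\frac{\left|\sum_{k=1}^n\frac{\partial f}{\partial z_k}(z)u_k\right|}{H_z(u,\overline u)^{1/2}}.$$ The Bloch space $\mathcal{B}(D)$ is the space of holomorphic $f$ on $D$ with $\beta_f<\infty$, with the norm $\|f\|_{\mathcal B}=|f(0)|+\beta_f$. For $z\in D$ let $$\omega(z)=\sup\{|f(z)| : f\in\mathcal{B}(D),\ f(0)=0,\ \|f\|_{\mathcal{B}}\le 1\}.$$ Let $\mu:D\to(0,\infty)$ be continuous, and let $H^\infty_\mu(D)$ be the space of holomorphic $f$ on $D$ with $\|f\|_{H^\infty_\mu}=\sup_{z\in D}\mu(z)|f(z)|<\infty$,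 with this norm. **Theorem.** Let $\psi:D\to\mathbb{C}$ and $\varphi:D\to D$ be holomorphic. If $\psi\in H^\infty_\mu(D)$ and $$\lim_{\varphi(z)\to\partial D}\tfrac12\,\mu(z)|\psi(z)|\,\omega(\varphi(z))=0,$$ that is, for every $\varepsilon>0$ there is an open set $U\supset\partial D$ such that $\tfrac12\mu(z)|\psi(z)|\omega(\varphi(z))<\varepsilon$ for all $z\in D$ with $\varphi(z)\in U$, then $W_{\psi,\varphi}f=\psi\,(f\circ\varphi)$ defines a compact (in particular, bounded) linear operator $W_{\psi,\varphi}:\mathcal{B}(D)\to H^\infty_\mu(D)$. -/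

import Mathlib

open Filter Topology MeasureTheory
open scoped ENNReal ComplexConjugate

noncomputable section

namespace BlochWCO

/-- The space `ℂⁿ`. -/
abbrev Cn (n : ℕ) : Type := Fin n → ℂ

/-- Extension by zero of a function on `D ⊆ ℂⁿ` to all of `ℂⁿ`
(used only to be able to differentiate at the points of an open set `D`). -/
def zeroExt {n : ℕ} {D : Set (Cn n)} {F : Type*} [Zero F] (f : D → F) : Cn n → F :=
  Function.extend Subtype.val f 0

/-- Holomorphy of a function defined on an (open) set `D ⊆ ℂⁿ`. -/
def IsHolomorphic {n : ℕ} {D : Set (Cn n)} {F : Type*} [NormedAddCommGroup F] [NormedSpace ℂ F]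
    (f : D → F) : Prop :=
  DifferentiableOn ℂ (zeroExt f) D

/-- A bounded homogeneous domain in `ℂⁿ` containing the origin: a bounded connected open set on
which the group of biholomorphic self-maps acts transitively. -/
structure BoundedHomogeneousDomain (n : ℕ) where
  /-- the underlying set -/
  carrier : Set (Cn n)
  isOpen : IsOpen carrier
  isConnected : IsConnected carrier
  isBounded : Bornology.IsBounded carrier
  homogeneous : ∀ a b : carrier, ∃ σ : carrier ≃ carrier,
    IsHolomorphic (fun z => (σ z : Cn n)) ∧ IsHolomorphic (fun z => (σ.symm z : Cn n)) ∧ σ a = b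
  zero_mem : (0 : Cn n) ∈ carrier

/-! ### The Bergman kernel and the Bergman metric -/

/-- `K` restricted to `D × D` is the Bergman kernel of `D`: for each `w ∈ D` the function
`K(·, w)` belongs to the Bergman space `A²(D)` of square integrable holomorphic functions and
`f(w) = ⟨f, K(·, w)⟩ = ∫_D f(z) conj (K(z, w)) dV(z)` for all `f ∈ A²(D)`. -/
def IsBergmanKernel {n : ℕ} (D : Set (Cn n)) (K : Cn n → Cn n → ℂ) : Prop :=
  ∀ w ∈ D, DifferentiableOn ℂ (fun z => K z w) D ∧
    MemLp (fun z => K z w) 2 (volume.restrict D) ∧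
    ∀ f : Cn n → ℂ, DifferentiableOn ℂ f D → MemLp f 2 (volume.restrict D) →
      f w = ∫ z in D, f z * conj (K z w)

open Classical in
/-- The Bergman kernel of `D` (unique on `D × D`; it exists for every open `D`, so the
default value `0` is never used for a domain). -/
def bergmanKernel {n : ℕ} (D : Set (Cn n)) : Cn n → Cn n → ℂ :=
  if h : ∃ K, IsBergmanKernel D K then h.choose else 0

/-- The Wirtinger derivative `∂F/∂z_j`. -/
def wirtinger {n : ℕ} (j : Fin n) (F : Cn n → ℂ) (z : Cn n) : ℂ :=
  (1 / 2) * (fderiv ℝ F z (Pi.single j 1) - Complex.I * fderiv ℝ F z (Pi.single j Complex.I))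

/-- The Wirtinger derivative `∂F/∂z̄_j`. -/
def wirtingerBar {n : ℕ} (j : Fin n) (F : Cn n → ℂ) (z : Cn n) : ℂ :=
  (1 / 2) * (fderiv ℝ F z (Pi.single j 1) + Complex.I * fderiv ℝ F z (Pi.single j Complex.I))

/-- The coefficient `g_{jk}(z) = ∂² log K(z, z) / ∂z_j ∂z̄_k` of the Bergman metric of `D`. -/
def bergmanCoeff {n : ℕ} (D : Set (Cn n)) (j k : Fin n) (z : Cn n) : ℂ :=
  wirtinger j (wirtingerBar k (fun w => ((Real.log (bergmanKernel D w w).re : ℝ) : ℂ))) z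

/-- The Bergman metric `H_z(u, v̄) = ∑_{j,k} g_{jk}(z) u_j conj (v_k)` of `D`. -/
def bergmanMetric {n : ℕ} (D : Set (Cn n)) (z u v : Cn n) : ℂ :=
  ∑ j, ∑ k, bergmanCoeff D j k z * u j * conj (v k)

/-- The length `H_z(u, ū)^{1/2}` of the vector `u` at `z`. -/
def bergmanLength {n : ℕ} (D : Set (Cn n)) (z u : Cn n) : ℝ :=
  √(bergmanMetric D z u u).re

/-! ### The Bloch space -/

/-- `Q_f(z) = sup_{u ≠ 0} |∇f(z) u| / H_z(u, ū)^{1/2}`, with values in `[0, ∞]`;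
here `∇f(z) u = ∑ ∂f/∂z_k(z) u_k` is the complex derivative of `f` at `z` applied to `u`. -/
def blochQ {n : ℕ} {D : Set (Cn n)} (f : D → ℂ) (z : D) : ℝ≥0∞ :=
  ⨆ u : Cn n, ⨆ _ : u ≠ 0,
    ‖fderiv ℂ (zeroExt f) z u‖ₑ / ENNReal.ofReal (bergmanLength D z u)

/-- `β_f = sup_{z ∈ D} Q_f(z)`, with values in `[0, ∞]`. -/
def blochBeta {n : ℕ} {D : Set (Cn n)} (f : D → ℂ) : ℝ≥0∞ :=
  ⨆ z : D, blochQ f z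

section helpers

variable {n : ℕ} {D : Set (Cn n)}

lemma zeroExt_apply {F : Type*} [Zero F] (f : D → F) (z : D) : zeroExt f z = f z :=
  Subtype.val_injective.extend_apply _ _ _

lemma zeroExt_add (f g : D → ℂ) : zeroExt (f + g) = zeroExt f + zeroExt g := by
  simpa [zeroExt] using Function.extend_add (Subtype.val : D → Cn n) f g 0 0

lemma zeroExt_smul (c : ℂ) (f : D → ℂ) : zeroExt (c • f) = c • zeroExt f := by
  simpa [zeroExt] using Function.extend_smul c (Subtype.val : D → Cn n) f 0

lemma zeroExt_zero : zeroExt (0 : D → ℂ) = 0 := by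
  simpa [zeroExt] using Function.extend_zero (γ := ℂ) (Subtype.val : D → Cn n)

lemma IsHolomorphic.add {f g : D → ℂ} (hf : IsHolomorphic f) (hg : IsHolomorphic g) :
    IsHolomorphic (f + g) := by
  unfold IsHolomorphic at *
  rw [zeroExt_add]
  exact DifferentiableOn.add hf hg

lemma IsHolomorphic.smul {f : D → ℂ} (c : ℂ) (hf : IsHolomorphic f) :
    IsHolomorphic (c • f) := by
  unfold IsHolomorphic at *
  rw [zeroExt_smul]
  exact DifferentiableOn.const_smul hf c

lemma isHolomorphic_zero : IsHolomorphic (0 : D → ℂ) := by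
  unfold IsHolomorphic
  rw [zeroExt_zero]
  exact differentiableOn_const 0

lemma IsHolomorphic.differentiableAt {f : D → ℂ} (hD : IsOpen D) (hf : IsHolomorphic f) (z : D) :
    DifferentiableAt ℂ (zeroExt f) z :=
  DifferentiableOn.differentiableAt hf (hD.mem_nhds z.2)

lemma enorm_fderiv_div_le_blochBeta (f : D → ℂ) (z : D) (u : Cn n) :
    ‖fderiv ℂ (zeroExt f) z u‖ₑ / ENNReal.ofReal (bergmanLength D z u) ≤ blochBeta f := by
  by_cases hu : u = 0
  · simp [hu]
  · refine le_trans ?_ (le_iSup (fun z : D => blochQ f z) z)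
    exact le_iSup₂ (f := fun (u : Cn n) (_ : u ≠ 0) =>
      ‖fderiv ℂ (zeroExt f) z u‖ₑ / ENNReal.ofReal (bergmanLength D z u)) u hu

lemma blochBeta_le {f : D → ℂ} {c : ℝ≥0∞}
    (h : ∀ (z : D) (u : Cn n),
      ‖fderiv ℂ (zeroExt f) z u‖ₑ / ENNReal.ofReal (bergmanLength D z u) ≤ c) :
    blochBeta f ≤ c :=
  iSup_le fun z => iSup₂_le fun u _ => h z u

lemma blochBeta_add_le (hD : IsOpen D) {f g : D → ℂ} (hf : IsHolomorphic f)
    (hg : IsHolomorphic g) : blochBeta (f + g) ≤ blochBeta f + blochBeta g := by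
  refine blochBeta_le fun z u => ?_
  refine le_trans ?_ (add_le_add (enorm_fderiv_div_le_blochBeta f z u)
    (enorm_fderiv_div_le_blochBeta g z u))
  rw [zeroExt_add, fderiv_add (hf.differentiableAt hD z) (hg.differentiableAt hD z),
    ← ENNReal.add_div]
  exact ENNReal.div_le_div_right (enorm_add_le _ _) _

lemma blochBeta_smul (hD : IsOpen D) (c : ℂ) {f : D → ℂ} (hf : IsHolomorphic f) :
    blochBeta (c • f) = ‖c‖ₑ * blochBeta f := by
  simp only [blochBeta, blochQ, ENNReal.mul_iSup]
  refine iSup_congr fun z => iSup_congr fun u => iSup_congr fun _ => ?_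
  rw [zeroExt_smul, fderiv_const_smul (hf.differentiableAt hD z), ← mul_div_assoc]
  simp [enorm_mul]

lemma blochBeta_zero : blochBeta (0 : D → ℂ) = 0 := by
  refine le_antisymm (blochBeta_le fun z u => ?_) bot_le
  rw [zeroExt_zero]
  simp

lemma eq_of_blochBeta_eq_zero (hD : IsOpen D) (hc : IsPreconnected D) {f : D → ℂ}
    (hf : IsHolomorphic f) (h : blochBeta f = 0) (z w : D) : f z = f w := by
  have key : Set.EqOn (fderiv ℂ (zeroExt f)) 0 D := by
    intro x hx
    ext u
    have h1 := enorm_fderiv_div_le_blochBeta f ⟨x, hx⟩ u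
    rw [h, nonpos_iff_eq_zero, ENNReal.div_eq_zero_iff] at h1
    simpa using h1
  have := hD.is_const_of_fderiv_eq_zero hc hf key z.2 w.2
  rwa [zeroExt_apply, zeroExt_apply] at this

end helpers

/-- The Bloch space `𝓑(D) = {f ∈ H(D) : β_f < ∞}` as a space of functions on `D`. -/
def blochSubmodule {n : ℕ} (D : BoundedHomogeneousDomain n) : Submodule ℂ (D.carrier → ℂ) where
  carrier := {f | IsHolomorphic f ∧ blochBeta f < ∞}
  add_mem' := fun hf hg => ⟨hf.1.add hg.1,
    (blochBeta_add_le D.isOpen hf.1 hg.1).trans_lt (ENNReal.add_lt_top.2 ⟨hf.2, hg.2⟩)⟩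
  zero_mem' := ⟨isHolomorphic_zero, by rw [blochBeta_zero]; exact ENNReal.zero_lt_top⟩
  smul_mem' := fun c f hf => ⟨hf.1.smul c, by
    rw [blochBeta_smul D.isOpen c hf.1]
    exact ENNReal.mul_lt_top enorm_lt_top hf.2⟩

/-- The Bloch space `𝓑(D)`, which carries the norm topology only (not that of pointwise
convergence). -/
def BlochSpace {n : ℕ} (D : BoundedHomogeneousDomain n) : Type := blochSubmodule D

namespace BlochSpace

variable {n : ℕ} {D : BoundedHomogeneousDomain n}

instance : AddCommGroup (BlochSpace D) := inferInstanceAs (AddCommGroup (blochSubmodule D))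

instance : Module ℂ (BlochSpace D) := inferInstanceAs (Module ℂ (blochSubmodule D))

/-- The function on `D` underlying an element of the Bloch space. -/
def toFun (f : BlochSpace D) : D.carrier → ℂ := Subtype.val f

instance : CoeFun (BlochSpace D) (fun _ => D.carrier → ℂ) := ⟨toFun⟩

/-- The Bloch norm `‖f‖ = |f(0)| + β_f`. -/
instance : Norm (BlochSpace D) :=
  ⟨fun f => ‖f ⟨0, D.zero_mem⟩‖ + (blochBeta f.toFun).toReal⟩

lemma norm_def (f : BlochSpace D) :
    ‖f‖ = ‖f ⟨0, D.zero_mem⟩‖ + (blochBeta f.toFun).toReal := rfl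

lemma isHolomorphic (f : BlochSpace D) : IsHolomorphic f.toFun := f.2.1

lemma blochBeta_lt_top (f : BlochSpace D) : blochBeta f.toFun < ∞ := f.2.2

lemma toFun_injective : Function.Injective (toFun : BlochSpace D → D.carrier → ℂ) :=
  Subtype.val_injective

lemma toFun_add (f g : BlochSpace D) : (f + g).toFun = f.toFun + g.toFun := rfl

lemma toFun_smul (c : ℂ) (f : BlochSpace D) : (c • f).toFun = c • f.toFun := rfl

lemma toFun_zero : (0 : BlochSpace D).toFun = 0 := rfl

lemma normCore : NormedSpace.Core ℂ (BlochSpace D) where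
  norm_nonneg f := add_nonneg (norm_nonneg _) ENNReal.toReal_nonneg
  norm_smul c f := by
    rw [norm_def, norm_def, toFun_smul, blochBeta_smul D.isOpen c f.isHolomorphic,
      ENNReal.toReal_mul, Pi.smul_apply, norm_smul, toReal_enorm, mul_add]
  norm_triangle f g := by
    have h := ENNReal.toReal_mono (ENNReal.add_lt_top.2 ⟨f.blochBeta_lt_top, g.blochBeta_lt_top⟩).ne
      (blochBeta_add_le D.isOpen f.isHolomorphic g.isHolomorphic)
    rw [ENNReal.toReal_add f.blochBeta_lt_top.ne g.blochBeta_lt_top.ne] at h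
    rw [norm_def, norm_def, norm_def, toFun_add, Pi.add_apply]
    linarith [norm_add_le (f ⟨0, D.zero_mem⟩) (g ⟨0, D.zero_mem⟩)]
  norm_eq_zero_iff f := by
    constructor
    · intro h
      rw [norm_def, add_eq_zero_iff_of_nonneg (norm_nonneg _) ENNReal.toReal_nonneg,
        norm_eq_zero, ENNReal.toReal_eq_zero_iff] at h
      have hb : blochBeta f.toFun = 0 := h.2.resolve_right f.blochBeta_lt_top.ne
      refine toFun_injective (funext fun z => ?_)
      rw [eq_of_blochBeta_eq_zero D.isOpen D.isConnected.isPreconnected f.isHolomorphic hb z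
        ⟨0, D.zero_mem⟩, h.1]
      rfl
    · rintro rfl
      simp [norm_def, toFun_zero, blochBeta_zero]

instance : NormedAddCommGroup (BlochSpace D) := NormedAddCommGroup.ofCore normCore

instance : NormedSpace ℂ (BlochSpace D) := NormedSpace.ofCore normCore

end BlochSpace

/-- `ω(z) = sup {|f(z)| : f ∈ 𝓑(D), f(0) = 0, ‖f‖ ≤ 1}`, with values in `[0, ∞]`. -/
def omega {n : ℕ} (D : BoundedHomogeneousDomain n) (z : D.carrier) : ℝ≥0∞ :=
  ⨆ (f : BlochSpace D) (_ : f ⟨0, D.zero_mem⟩ = 0 ∧ ‖f‖ ≤ 1), ‖f z‖ₑ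

/-! ### The weighted Banach space of holomorphic functions -/

/-- A weight on `D`: a continuous strictly positive function. -/
structure Weight {n : ℕ} (D : BoundedHomogeneousDomain n) where
  /-- the underlying function -/
  toFun : D.carrier → ℝ
  continuous : Continuous toFun
  pos : ∀ z, 0 < toFun z

instance {n : ℕ} {D : BoundedHomogeneousDomain n} : CoeFun (Weight D) (fun _ => D.carrier → ℝ) :=
  ⟨Weight.toFun⟩

section helpers

variable {n : ℕ} {D : BoundedHomogeneousDomain n}

lemma weighted_smul (μ : Weight D) (c : ℂ) (f : D.carrier → ℂ) (z : D.carrier) :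
    μ z * ‖(c • f) z‖ = ‖c‖ * (μ z * ‖f z‖) := by
  rw [Pi.smul_apply, norm_smul]
  ring

lemma weighted_add_le (μ : Weight D) (f g : D.carrier → ℂ) (z : D.carrier) :
    μ z * ‖(f + g) z‖ ≤ μ z * ‖f z‖ + μ z * ‖g z‖ := by
  rw [← mul_add]
  exact mul_le_mul_of_nonneg_left (norm_add_le _ _) (μ.pos z).le

end helpers

/-- `H^∞_μ(D) = {f ∈ H(D) : sup_{z ∈ D} μ(z)|f(z)| < ∞}` as a space of functions on `D`. -/
def hInfSubmodule {n : ℕ} (D : BoundedHomogeneousDomain n) (μ : Weight D) :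
    Submodule ℂ (D.carrier → ℂ) where
  carrier := {f | IsHolomorphic f ∧ BddAbove (Set.range fun z => μ z * ‖f z‖)}
  add_mem' := by
    rintro f g ⟨hf, a, ha⟩ ⟨hg, b, hb⟩
    refine ⟨hf.add hg, a + b, ?_⟩
    rintro _ ⟨z, rfl⟩
    exact (weighted_add_le μ f g z).trans (add_le_add (ha ⟨z, rfl⟩) (hb ⟨z, rfl⟩))
  zero_mem' := by
    refine ⟨isHolomorphic_zero, 0, ?_⟩
    rintro _ ⟨z, rfl⟩
    simp
  smul_mem' := by
    rintro c f ⟨hf, a, ha⟩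
    refine ⟨hf.smul c, ‖c‖ * a, ?_⟩
    rintro _ ⟨z, rfl⟩
    simp only [weighted_smul]
    exact mul_le_mul_of_nonneg_left (ha ⟨z, rfl⟩) (norm_nonneg c)

/-- The weighted space `H^∞_μ(D)`, which carries the norm topology only. -/
def HInf {n : ℕ} (D : BoundedHomogeneousDomain n) (μ : Weight D) : Type := hInfSubmodule D μ

namespace HInf

variable {n : ℕ} {D : BoundedHomogeneousDomain n} {μ : Weight D}

instance : AddCommGroup (HInf D μ) := inferInstanceAs (AddCommGroup (hInfSubmodule D μ))

instance : Module ℂ (HInf D μ) := inferInstanceAs (Module ℂ (hInfSubmodule D μ))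

/-- The function on `D` underlying an element of `H^∞_μ(D)`. -/
def toFun (f : HInf D μ) : D.carrier → ℂ := Subtype.val f

instance : CoeFun (HInf D μ) (fun _ => D.carrier → ℂ) := ⟨toFun⟩

/-- The norm `‖f‖ = sup_{z ∈ D} μ(z)|f(z)|`. -/
instance : Norm (HInf D μ) := ⟨fun f => ⨆ z, μ z * ‖f z‖⟩

lemma norm_def (f : HInf D μ) : ‖f‖ = ⨆ z, μ z * ‖f z‖ := rfl

lemma bddAbove (f : HInf D μ) : BddAbove (Set.range fun z => μ z * ‖f z‖) := f.2.2

lemma le_norm (f : HInf D μ) (z : D.carrier) : μ z * ‖f z‖ ≤ ‖f‖ := le_ciSup f.bddAbove z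

lemma toFun_injective : Function.Injective (toFun : HInf D μ → D.carrier → ℂ) :=
  Subtype.val_injective

lemma toFun_add (f g : HInf D μ) : (f + g).toFun = f.toFun + g.toFun := rfl

lemma toFun_smul (c : ℂ) (f : HInf D μ) : (c • f).toFun = c • f.toFun := rfl

lemma toFun_zero : (0 : HInf D μ).toFun = 0 := rfl

lemma normCore : NormedSpace.Core ℂ (HInf D μ) where
  norm_nonneg f := Real.iSup_nonneg fun z => mul_nonneg (μ.pos z).le (norm_nonneg _)
  norm_smul c f := by
    rw [norm_def, norm_def, toFun_smul, Real.mul_iSup_of_nonneg (norm_nonneg c)]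
    simp only [weighted_smul]
  norm_triangle f g := by
    have : Nonempty D.carrier := ⟨⟨0, D.zero_mem⟩⟩
    refine ciSup_le fun z => ?_
    rw [toFun_add]
    exact (weighted_add_le μ f.toFun g.toFun z).trans (add_le_add (f.le_norm z) (g.le_norm z))
  norm_eq_zero_iff f := by
    constructor
    · intro h
      refine toFun_injective (funext fun z => ?_)
      have h1 := f.le_norm z
      rw [h] at h1
      have h2 : ‖f z‖ ≤ 0 := nonpos_of_mul_nonpos_right h1 (μ.pos z)
      rw [toFun_zero]
      simpa using h2
    · rintro rfl
      simp [norm_def, toFun_zero]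

instance : NormedAddCommGroup (HInf D μ) := NormedAddCommGroup.ofCore normCore

instance : NormedSpace ℂ (HInf D μ) := NormedSpace.ofCore normCore

end HInf

end BlochWCO

end

/-! The proof rests on two facts. Subtracting the constant `f 0` does not change `β_f`, so scaling
gives `|f(z)| ≤ |f(0)| + ‖f‖ ω(z)` (`enorm_le_omega`). Since `D` is bounded, the set of points of
`D` outside a neighbourhood of `∂D` is compact. The limit hypothesis therefore yields, for each `ε`,
a compact `S ⊆ D` such that `μ|ψ||f ∘ φ| ≤ μ|ψ||f(0)| + ε‖f‖` wherever `φ(z) ∉ S`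
(`exists_isCompact_weighted_le`). Where `φ(z) ∈ S`, the bound on `μ|ψ|` reduces everything to the
size of `f` on `S`.

The second fact is a Montel theorem: the unit ball of the Bloch space is compact for pointwise
convergence (`exists_tendsto_apply`), and there this convergence is uniform on compact sets
(`eventually_norm_sub_le`). Hence `W f → W g` in norm whenever `f → g` pointwise in the ball, and
the image of the closed unit ball is compact.

The Montel theorem needs the Bergman metric to be locally bounded by the Euclidean one
(`exists_bergmanLength_le`), so that Bloch functions are locally Lipschitz with constants
proportional to the norm. For this, `log K(z,z)` has to be C²: the kernel exists by Riesz
representation on the closed subspace `A² ⊆ L²`, is positive on the diagonal, and is jointly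
holomorphic in `(z, conj w)`. -/

noncomputable section

namespace BlochWCO

/-! ### Holomorphic functions of several variables: Cauchy estimates, limits, regularity. -/

section Holomorphic

open Metric Set

/-- Puts a sup bound in the form required by Schwarz-type lemmas, at the cost of a factor 2. -/
lemma mapsTo_closedBall_of_norm_le {E F : Type*} [NormedAddCommGroup E]
    [NormedAddCommGroup F] {f : E → F} {c : E} {R M : ℝ} (hR : 0 < R)
    (hM : ∀ z ∈ ball c R, ‖f z‖ ≤ M) : MapsTo f (ball c R) (closedBall (f c) (2 * M)) := by
  intro z hz
  rw [mem_closedBall, dist_eq_norm]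
  linarith [norm_sub_le (f z) (f c), hM z hz, hM c (mem_ball_self hR)]

lemma exists_ball_subset_norm_le {E F : Type*} [NormedAddCommGroup E]
    [NormedAddCommGroup F] {f : E → F} {U : Set E} (hU : IsOpen U) (hf : ContinuousOn f U) {c : E} (hc : c ∈ U) :
    ∃ R > 0, ∃ M, ball c R ⊆ U ∧ ∀ z ∈ ball c R, ‖f z‖ ≤ M := by
  have h1 : ∀ᶠ z in 𝓝 c, ‖f z‖ < ‖f c‖ + 1 :=
    (hf.continuousAt (hU.mem_nhds hc)).norm.eventually_lt_const (by linarith)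
  obtain ⟨R, hR, h⟩ := Metric.mem_nhds_iff.1 (inter_mem (hU.mem_nhds hc) h1)
  exact ⟨R, hR, ‖f c‖ + 1, fun z hz => (h hz).1, fun z hz => (h hz).2.le⟩

variable {E F : Type*} [NormedAddCommGroup E] [NormedSpace ℂ E]
  [NormedAddCommGroup F] [NormedSpace ℂ F]

/-- Cauchy's estimate for the derivative. -/
lemma norm_fderiv_le_of_norm_le {f : E → F} {c : E} {R M : ℝ} (hR : 0 < R)
    (hd : DifferentiableOn ℂ f (ball c R)) (hM : ∀ z ∈ ball c R, ‖f z‖ ≤ M) :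
    ‖fderiv ℂ f c‖ ≤ 2 * M / R :=
  Complex.norm_fderiv_le_div_of_mapsTo_ball hd (mapsTo_closedBall_of_norm_le hR hM) hR

/-- The first order Taylor formula with a remainder that is uniform over bounded families. -/
lemma norm_sub_sub_fderiv_le {f : E → F} {c z : E} {R M : ℝ} (hR : 0 < R)
    (hd : DifferentiableOn ℂ f (ball c R)) (hM : ∀ z ∈ ball c R, ‖f z‖ ≤ M)
    (hz : z ∈ ball c R) :
    ‖f z - f c - fderiv ℂ f c (z - c)‖ ≤ 4 * M * (‖z - c‖ / R) ^ 2 := by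
  have hM0 : 0 ≤ M := (norm_nonneg _).trans (hM c (mem_ball_self hR))
  have hfd : DifferentiableAt ℂ f c := hd.differentiableAt (ball_mem_nhds c hR)
  set g : E → F := fun w => f w - fderiv ℂ f c (w - c) with hg
  have hgc : g c = f c := by simp [hg]
  have hgd : DifferentiableOn ℂ g (ball c R) := by
    refine hd.sub (Differentiable.differentiableOn ?_)
    fun_prop
  have hmaps : MapsTo g (ball c R) (closedBall (g c) (4 * M)) := by
    intro w hw
    have h1 : ‖f w - f c‖ ≤ 2 * M := by
      simpa [dist_eq_norm] using mapsTo_closedBall_of_norm_le hR hM hw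
    have h2 : ‖fderiv ℂ f c (w - c)‖ ≤ 2 * M := by
      refine (ContinuousLinearMap.le_opNorm _ _).trans ?_
      have h3 := norm_fderiv_le_of_norm_le hR hd hM
      have h4 : ‖w - c‖ ≤ R := by simpa [dist_eq_norm] using (mem_ball.1 hw).le
      calc _ ≤ 2 * M / R * R := by gcongr
        _ = 2 * M := by field_simp
    have h5 : g w - g c = (f w - f c) - fderiv ℂ f c (w - c) := by simp [hg]; abel
    rw [mem_closedBall, dist_eq_norm, h5]
    linarith [norm_sub_le (f w - f c) (fderiv ℂ f c (w - c))]
  have hlo : (g · - g c) =o[𝓝 c] (fun w => ‖w - c‖ ^ 1) := by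
    have := hfd.hasFDerivAt.isLittleO
    simp only [pow_one]
    refine Asymptotics.IsLittleO.norm_right ?_
    refine this.congr_left fun w => ?_
    simp [hg]; abel
  have key := Complex.dist_le_mul_div_pow_of_mapsTo_ball_of_isLittleO hgd hmaps hlo hz
  rw [dist_eq_norm, dist_eq_norm] at key
  have h6 : g z - g c = f z - f c - fderiv ℂ f c (z - c) := by simp [hg]; abel
  rwa [h6] at key

/-- A pointwise limit of a bounded family of holomorphic functions is differentiable, and its
derivative is the limit of the derivatives if these converge. -/
lemma hasFDerivAt_of_tendsto_of_norm_le {ι : Type*} {l : Filter ι} [l.NeBot] {f : ι → E → F}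
    {g : E → F} {c : E} {R M : ℝ} {L : E →L[ℂ] F} (hR : 0 < R)
    (hd : ∀ᶠ i in l, DifferentiableOn ℂ (f i) (ball c R))
    (hM : ∀ᶠ i in l, ∀ z ∈ ball c R, ‖f i z‖ ≤ M)
    (hg : ∀ z ∈ ball c R, Tendsto (fun i => f i z) l (𝓝 (g z)))
    (hL : Tendsto (fun i => fderiv ℂ (f i) c) l (𝓝 L)) : HasFDerivAt g L c := by
  have key : ∀ z ∈ ball c R, ‖g z - g c - L (z - c)‖ ≤ 4 * M / R ^ 2 * ‖z - c‖ ^ 2 := by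
    intro z hz
    have h1 : Tendsto (fun i => ‖f i z - f i c - fderiv ℂ (f i) c (z - c)‖) l
        (𝓝 ‖g z - g c - L (z - c)‖) :=
      (((hg z hz).sub (hg c (mem_ball_self hR))).sub
        (((ContinuousLinearMap.apply ℂ F (z - c)).continuous.tendsto L).comp hL)).norm
    refine le_of_tendsto h1 ?_
    filter_upwards [hd, hM] with i hi hi'
    refine (norm_sub_sub_fderiv_le hR hi hi' hz).trans_eq ?_
    field_simp
  rw [hasFDerivAt_iff_isLittleO]
  refine (Asymptotics.IsBigO.of_bound (4 * M / R ^ 2) (g := fun z => ‖z - c‖ ^ 2) ?_).trans_isLittleO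
    ?_
  · filter_upwards [ball_mem_nhds c hR] with z hz
    simpa using key z hz
  · have h : (fun z : E => ‖z - c‖ ^ 2) =o[𝓝 c] (fun z => ‖z - c‖ ^ 1) := by
      refine (Asymptotics.isLittleO_pow_pow one_lt_two).comp_tendsto ?_
      have : Tendsto (fun z : E => ‖z - c‖) (𝓝 c) (𝓝 ‖c - c‖) := by
        exact Continuous.tendsto (by fun_prop) c
      simpa using this
    simpa using h.norm_right

/-- Uniform limits of bounded families of holomorphic functions are holomorphic. -/
lemma differentiableAt_of_tendstoUniformlyOn [CompleteSpace F] {ι : Type*} {l : Filter ι}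
    [l.NeBot] {f : ι → E → F} {g : E → F} {c : E} {R M : ℝ} (hR : 0 < R)
    (hd : ∀ᶠ i in l, DifferentiableOn ℂ (f i) (ball c R))
    (hM : ∀ᶠ i in l, ∀ z ∈ ball c R, ‖f i z‖ ≤ M)
    (hg : TendstoUniformlyOn f g l (ball c R)) : DifferentiableAt ℂ g c := by
  -- Cauchy's estimate for `f i - f j` turns uniform closeness of values into closeness of
  -- derivatives.
  have hc : Cauchy (map (fun i => fderiv ℂ (f i) c) l) := by
    rw [Metric.cauchy_iff]
    refine ⟨inferInstance, fun ε hε => ?_⟩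
    have hε' : 0 < ε * R / 8 := by positivity
    have h1 := (Metric.tendstoUniformlyOn_iff.1 hg _ hε').and hd
    refine ⟨_, image_mem_map h1, ?_⟩
    rintro _ ⟨i, ⟨hi, hid⟩, rfl⟩ _ ⟨j, ⟨hj, hjd⟩, rfl⟩
    have h2 : ∀ z ∈ ball c R, ‖(f i - f j) z‖ ≤ ε * R / 4 := by
      intro z hz
      have h3 := dist_triangle_left (f i z) (f j z) (g z)
      rw [Pi.sub_apply, ← dist_eq_norm]
      linarith [hi z hz, hj z hz]
    have h4 := norm_fderiv_le_of_norm_le hR (hid.sub hjd) h2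
    rw [fderiv_sub (hid.differentiableAt (ball_mem_nhds c hR))
      (hjd.differentiableAt (ball_mem_nhds c hR)), ← dist_eq_norm] at h4
    refine h4.trans_lt ?_
    have : 2 * (ε * R / 4) / R = ε / 2 := by field_simp; norm_num
    rw [this]
    linarith
  obtain ⟨L, hL⟩ := CompleteSpace.complete hc
  exact (hasFDerivAt_of_tendsto_of_norm_le hR hd hM (fun z hz => hg.tendsto_at hz)
    hL).differentiableAt

/-- Directional derivatives of holomorphic functions are holomorphic. -/
lemma differentiableOn_fderiv_apply [CompleteSpace F] {f : E → F} {U : Set E} (hU : IsOpen U)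
    (hf : DifferentiableOn ℂ f U) (u : E) : DifferentiableOn ℂ (fun z => fderiv ℂ f z u) U := by
  intro c hc
  refine DifferentiableAt.differentiableWithinAt ?_
  obtain ⟨R', hR', M, hsub, hM⟩ := exists_ball_subset_norm_le hU hf.continuousOn hc
  -- Half the radius, so that balls of radius `R` about every point of `ball c R` stay inside `U`.
  obtain ⟨R, rfl⟩ : ∃ R, R' = 2 * R := ⟨R' / 2, by ring⟩
  have hR : 0 < R := by linarith
  have hM0 : 0 ≤ M := (norm_nonneg _).trans (hM c (mem_ball_self hR'))
  have hball : ∀ z ∈ ball c R, ball z R ⊆ ball c (2 * R) := fun z hz =>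
    ball_subset_ball' (by rw [mem_ball] at hz; linarith)
  have hsmall : ∀ᶠ t : ℂ in 𝓝[≠] 0, t ≠ 0 ∧ ‖t • u‖ < R := by
    refine (eventually_mem_nhdsWithin).and (eventually_nhdsWithin_of_eventually_nhds ?_)
    have : Tendsto (fun t : ℂ => ‖t • u‖) (𝓝 0) (𝓝 ‖(0 : ℂ) • u‖) :=
      Continuous.tendsto (by fun_prop) 0
    exact this.eventually_lt_const (by simpa using hR)
  -- Difference quotients are holomorphic in `z`, and by the Taylor bound they converge to the
  -- directional derivative uniformly, with error `O(‖t‖)`.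
  set G : ℂ → E → F := fun t z => t⁻¹ • (f (z + t • u) - f z) with hG
  have hest : ∀ t : ℂ, t ≠ 0 → ‖t • u‖ < R → ∀ z ∈ ball c R,
      ‖G t z - fderiv ℂ f z u‖ ≤ 4 * M * (‖u‖ / R) ^ 2 * ‖t‖ := by
    intro t ht htR z hz
    have h1 := norm_sub_sub_fderiv_le (z := z + t • u) hR (hf.mono ((hball z hz).trans hsub))
      (fun w hw => hM w (hball z hz hw)) (by simpa using htR)
    rw [add_sub_cancel_left, map_smul] at h1
    have h2 : G t z - fderiv ℂ f z u = t⁻¹ • (f (z + t • u) - f z - t • fderiv ℂ f z u) := by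
      rw [smul_sub, smul_smul, inv_mul_cancel₀ ht, one_smul]
    rw [h2, norm_smul, norm_inv]
    calc _ ≤ ‖t‖⁻¹ * (4 * M * (‖t • u‖ / R) ^ 2) := by gcongr
      _ = _ := by
        rw [norm_smul]
        have : ‖t‖ ≠ 0 := by simpa using ht
        field_simp
  refine differentiableAt_of_tendstoUniformlyOn (l := 𝓝[≠] (0 : ℂ)) (f := G) hR
    (M := 4 * M * (‖u‖ / R) ^ 2 * 1 + 2 * M / R * ‖u‖) ?_ ?_ ?_
  · filter_upwards [hsmall] with t ht
    refine DifferentiableOn.const_smul (DifferentiableOn.sub ?_ ?_) _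
    · refine hf.comp (Differentiable.differentiableOn (by fun_prop)) fun z hz => hsub ?_
      exact hball z hz (by simpa using ht.2)
    · exact hf.mono fun z hz => hsub (hball z hz (mem_ball_self hR))
  · have h1 : ∀ᶠ t : ℂ in 𝓝[≠] 0, ‖t‖ < 1 :=
      eventually_nhdsWithin_of_eventually_nhds
        (continuous_norm.continuousAt.eventually_lt_const (by simp))
    filter_upwards [hsmall, h1] with t ht ht1 z hz
    have h2 := hest t ht.1 ht.2 z hz
    have h3 := norm_fderiv_le_of_norm_le hR (hf.mono ((hball z hz).trans hsub))
      (fun w hw => hM w (hball z hz hw))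
    have h4 : ‖fderiv ℂ f z u‖ ≤ 2 * M / R * ‖u‖ :=
      (ContinuousLinearMap.le_opNorm _ _).trans (by gcongr)
    have h5 : 4 * M * (‖u‖ / R) ^ 2 * ‖t‖ ≤ 4 * M * (‖u‖ / R) ^ 2 * 1 := by gcongr
    linarith [norm_le_norm_sub_add (G t z) (fderiv ℂ f z u)]
  · rw [Metric.tendstoUniformlyOn_iff]
    intro ε hε
    have h1 : Tendsto (fun t : ℂ => 4 * M * (‖u‖ / R) ^ 2 * ‖t‖) (𝓝[≠] 0) (𝓝 0) := by
      refine tendsto_nhdsWithin_of_tendsto_nhds ?_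
      have : Tendsto (fun t : ℂ => 4 * M * (‖u‖ / R) ^ 2 * ‖t‖) (𝓝 0)
          (𝓝 (4 * M * (‖u‖ / R) ^ 2 * ‖(0 : ℂ)‖)) := Continuous.tendsto (by fun_prop) 0
      simpa using this
    filter_upwards [hsmall, h1.eventually_lt_const hε] with t ht htε z hz
    rw [dist_comm, dist_eq_norm]
    exact (hest t ht.1 ht.2 z hz).trans_lt htε

/-- Holomorphic functions on open subsets of finite-dimensional spaces are infinitely
differentiable. -/
lemma contDiffOn_of_differentiableOn [FiniteDimensional ℂ E] [CompleteSpace F] {f : E → F}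
    {U : Set E} (hU : IsOpen U) (hf : DifferentiableOn ℂ f U) (m : ℕ) : ContDiffOn ℂ m f U := by
  induction m generalizing f with
  | zero => simpa using hf.continuousOn
  | succ m ih =>
    push_cast
    refine (contDiffOn_succ_iff_fderiv_of_isOpen hU).2 ⟨hf, by simp, ?_⟩
    refine contDiffOn_clm_apply.2 fun u => ih ?_
    exact differentiableOn_fderiv_apply hU hf u

/-- A locally bounded separately holomorphic function is holomorphic. -/
lemma differentiableAt_uncurry_of_separately {E' : Type*} [NormedAddCommGroup E']
    [NormedSpace ℂ E'] {f : E → E' → F} {a : E} {b : E'} {R M : ℝ} (hR : 0 < R)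
    (h₁ : ∀ w ∈ ball b R, DifferentiableOn ℂ (fun z => f z w) (ball a R))
    (h₂ : ∀ z ∈ ball a R, DifferentiableOn ℂ (fun w => f z w) (ball b R))
    (hM : ∀ z ∈ ball a R, ∀ w ∈ ball b R, ‖f z w‖ ≤ M) :
    DifferentiableAt ℂ (fun p : E × E' => f p.1 p.2) (a, b) := by
  have hb := mem_ball_self (x := b) hR
  have ha := mem_ball_self (x := a) hR
  have hM0 : 0 ≤ M := (norm_nonneg _).trans (hM a ha b hb)
  set A := fderiv ℂ (fun z => f z b) a
  set B := fderiv ℂ (fun w => f a w) b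
  have hsnd : HasFDerivAt (fun p : E × E' => f a p.2) (B ∘L ContinuousLinearMap.snd ℂ E E')
      (a, b) :=
    HasFDerivAt.comp (g := fun w => f a w) (a, b)
      ((h₂ a ha).differentiableAt (ball_mem_nhds b hR)).hasFDerivAt
      (hasFDerivAt_snd)
  have hfst : HasFDerivAt (fun p : E × E' => f p.1 p.2 - f a p.2)
      (A ∘L ContinuousLinearMap.fst ℂ E E') (a, b) := by
    -- The `z`-derivative at `a` is Lipschitz in `w`: `f(·, w) - f(·, b)` is `O(‖w - b‖)` by
    -- Schwarz, and Cauchy's estimate carries this over to the derivative.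
    have key : ∀ z ∈ ball a R, ∀ w ∈ ball b R, ‖f z w - f a w - A (z - a)‖ ≤
        (8 * M / R ^ 2) * (max ‖z - a‖ ‖w - b‖) ^ 2 := by
      intro z hz w hw
      have h3 := norm_sub_sub_fderiv_le hR (h₁ w hw) (fun z hz => hM z hz w hw) hz
      have h4 : ∀ z ∈ ball a R, ‖f z w - f z b‖ ≤ 2 * M / R * ‖w - b‖ := by
        intro z hz
        have := Complex.dist_le_div_mul_dist_of_mapsTo_ball (h₂ z hz)
          (mapsTo_closedBall_of_norm_le hR (hM z hz)) hw
        simpa [dist_eq_norm] using this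
      have h5 := norm_fderiv_le_of_norm_le hR ((h₁ w hw).sub (h₁ b hb)) h4
      rw [fderiv_sub ((h₁ w hw).differentiableAt (ball_mem_nhds a hR))
        ((h₁ b hb).differentiableAt (ball_mem_nhds a hR))] at h5
      have h6 := ContinuousLinearMap.le_of_opNorm_le _ h5 (z - a)
      have h7 : f z w - f a w - A (z - a) =
          (f z w - f a w - fderiv ℂ (fun z => f z w) a (z - a)) +
            (fderiv ℂ (fun z => f z w) a - A) (z - a) := by
        simp
      rw [h7]
      refine (norm_add_le _ _).trans ((add_le_add h3 h6).trans ?_)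
      set m := max ‖z - a‖ ‖w - b‖
      have hza : ‖z - a‖ ≤ m := le_max_left _ _
      have hwb : ‖w - b‖ ≤ m := le_max_right _ _
      calc _ ≤ 4 * M * (m / R) ^ 2 + 2 * (2 * M / R * m) / R * m := by gcongr
        _ = _ := by field_simp; ring
    rw [hasFDerivAt_iff_isLittleO]
    refine (Asymptotics.IsBigO.of_bound (8 * M / R ^ 2)
      (g := fun p : E × E' => ‖p - (a, b)‖ ^ 2) ?_).trans_isLittleO ?_
    · filter_upwards [ball_mem_nhds (a, b) hR] with p hp
      rw [← ball_prod_same] at hp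
      simpa [Prod.norm_def] using key p.1 hp.1 p.2 hp.2
    · have h : (fun p : E × E' => ‖p - (a, b)‖ ^ 2) =o[𝓝 (a, b)] (fun p => ‖p - (a, b)‖ ^ 1) := by
        refine (Asymptotics.isLittleO_pow_pow one_lt_two).comp_tendsto ?_
        have : Tendsto (fun p : E × E' => ‖p - (a, b)‖) (𝓝 (a, b)) (𝓝 ‖(a, b) - (a, b)‖) :=
          Continuous.tendsto (by fun_prop) _
        simpa using this
      simpa using h.norm_right
  have := (hfst.add hsnd).differentiableAt
  refine this.congr_of_eventuallyEq (Eventually.of_forall fun p => ?_)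
  simp

end Holomorphic

/-! ### The mean value property and bounded point evaluations on `A²`. -/

section MeanValue

open Metric Set

variable {n : ℕ}

lemma measurePreserving_smul_of_norm_eq_one {ζ : ℂ} (hζ : ‖ζ‖ = 1) :
    MeasurePreserving (fun v : Cn n => ζ • v) := by
  have h : MeasurePreserving (fun v : ℂ => ζ * v) :=
    (rotation ⟨ζ, mem_sphere_zero_iff_norm.2 hζ⟩).measurePreserving
  exact volume_preserving_pi (f := fun _ : Fin n => fun v : ℂ => ζ * v) fun _ => h

lemma setIntegral_closedBall_smul {F : Type*} [NormedAddCommGroup F] [NormedSpace ℝ F] {ζ : ℂ}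
    (hζ : ‖ζ‖ = 1) (g : Cn n → F) (r : ℝ) :
    ∫ v in closedBall 0 r, g (ζ • v) = ∫ v in closedBall 0 r, g v := by
  have hζ0 : ζ ≠ 0 := by rintro rfl; simp at hζ
  have h := (measurePreserving_smul_of_norm_eq_one (n := n) hζ).setIntegral_preimage_emb
    (Homeomorph.smulOfNeZero ζ hζ0).measurableEmbedding g (closedBall 0 r)
  have h' : (fun v : Cn n => ζ • v) ⁻¹' closedBall 0 r = closedBall 0 r := by
    ext v
    simp [norm_smul, hζ]
  rwa [h'] at h

/-- The mean value property over a polydisc. -/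
lemma setIntegral_closedBall_add {f : Cn n → ℂ} {c : Cn n} {r R : ℝ} (hrR : r < R)
    (hf : DifferentiableOn ℂ f (ball c R)) :
    ∫ v in closedBall 0 r, f (c + v) = (volume (closedBall (0 : Cn n) r)).toReal * f c := by
  have hmem : ∀ ζ : ℂ, ‖ζ‖ ≤ 1 → ∀ v ∈ closedBall (0 : Cn n) r, c + ζ • v ∈ ball c R := by
    intro ζ hζ v hv
    rw [mem_closedBall_zero_iff] at hv
    rw [mem_ball, dist_eq_norm, add_sub_cancel_left, norm_smul]
    calc ‖ζ‖ * ‖v‖ ≤ 1 * ‖v‖ := by gcongr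
      _ < R := by linarith
  -- One-variable mean value on the disc `ζ ↦ c + ζ • v`. Integrating over `v` and swapping the
  -- integrals (`hA`, `hB`) gives the claim, since rotations preserve the polydisc and its volume.
  have havg : ∀ v ∈ closedBall (0 : Cn n) r,
      ∫ θ in (0)..2 * Real.pi, f (c + circleMap 0 1 θ • v) = (2 * Real.pi : ℂ) * f c := by
    intro v hv
    have hd : DifferentiableOn ℂ (fun ζ : ℂ => f (c + ζ • v)) (closedBall 0 1) := by
      refine hf.comp (Differentiable.differentiableOn (by fun_prop)) fun ζ hζ => ?_
      exact hmem ζ (by simpa using hζ) v hv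
    have h1 : DiffContOnCl ℂ (fun ζ : ℂ => f (c + ζ • v)) (ball 0 |1|) := by
      refine DifferentiableOn.diffContOnCl ?_
      rw [abs_one, closure_ball _ one_ne_zero]
      exact hd
    have h2 := h1.circleAverage
    rw [Real.circleAverage_def, inv_smul_eq_iff₀ (by positivity)] at h2
    rw [h2]
    simp
  have hint : Integrable (Function.uncurry fun (v : Cn n) (θ : ℝ) => f (c + circleMap 0 1 θ • v))
      ((volume.restrict (closedBall 0 r)).prod (volume.restrict (Icc 0 (2 * Real.pi)))) := by
    rw [Measure.prod_restrict]
    refine ContinuousOn.integrableOn_compact ((isCompact_closedBall _ _).prod isCompact_Icc) ?_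
    refine hf.continuousOn.comp (t := ball c R) ?_ ?_
    · exact Continuous.continuousOn (by fun_prop)
    · rintro ⟨v, θ⟩ ⟨hv, -⟩
      exact hmem _ (by simp) v hv
  have hpi : (0 : ℝ) ≤ 2 * Real.pi := by positivity
  have hpi' : (2 * Real.pi : ℂ) ≠ 0 := by
    exact_mod_cast (by positivity : (2 * Real.pi : ℝ) ≠ 0)
  have hA : ∫ v in closedBall (0 : Cn n) r, ∫ θ in Icc 0 (2 * Real.pi),
      f (c + circleMap 0 1 θ • v) =
      (volume (closedBall (0 : Cn n) r)).toReal * ((2 * Real.pi : ℂ) * f c) := by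
    rw [setIntegral_congr_fun (g := fun _ => (2 * Real.pi : ℂ) * f c) measurableSet_closedBall]
    · simp [Measure.real]
    · intro v hv
      simp only
      rw [← havg v hv, intervalIntegral.integral_of_le hpi, integral_Icc_eq_integral_Ioc]
  have hB : ∫ θ in Icc 0 (2 * Real.pi), ∫ v in closedBall (0 : Cn n) r,
      f (c + circleMap 0 1 θ • v) =
      (2 * Real.pi : ℂ) * ∫ v in closedBall (0 : Cn n) r, f (c + v) := by
    have : ∀ θ : ℝ, ∫ v in closedBall (0 : Cn n) r, f (c + circleMap 0 1 θ • v) =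
        ∫ v in closedBall (0 : Cn n) r, f (c + v) := fun θ =>
      setIntegral_closedBall_smul (by simp) (fun v => f (c + v)) r
    simp [this, Real.pi_pos.le]
  rw [integral_integral_swap hint, hB] at hA
  rw [mul_left_comm] at hA
  exact mul_left_cancel₀ hpi' hA

/-- Point evaluations are bounded on the Bergman space, locally uniformly in the point. -/
lemma exists_norm_sq_le_integral {D : Set (Cn n)} {c : Cn n} {R : ℝ} (hR : 0 < R)
    (hsub : ball c (2 * R) ⊆ D) :
    ∃ C : ℝ, 0 ≤ C ∧ ∀ f : Cn n → ℂ, DifferentiableOn ℂ f D → MemLp f 2 (volume.restrict D) →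
      ∀ z ∈ ball c R, ‖f z‖ ^ 2 ≤ C * ∫ ζ in D, ‖f ζ‖ ^ 2 := by
  set V := (volume (closedBall (0 : Cn n) (R / 2))).toReal
  have hV : 0 < V := ENNReal.toReal_pos (measure_closedBall_pos _ _ (by linarith)).ne'
    (isCompact_closedBall _ _).measure_lt_top.ne
  refine ⟨V⁻¹, by positivity, fun f hf hf2 z hz => ?_⟩
  have hzD : ball z R ⊆ D := (ball_subset_ball' (by rw [mem_ball] at hz; linarith)).trans hsub
  -- Applied to `f ^ 2`, the mean value property bounds `‖f z‖ ^ 2` by the `L²` integral directly,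
  -- without Cauchy–Schwarz.
  have h1 := setIntegral_closedBall_add (f := fun ζ => f ζ ^ 2) (r := R / 2) (by linarith)
    ((hf.mono hzD).pow 2)
  have h2 : IntegrableOn (fun ζ => ‖f ζ‖ ^ 2) D := hf2.integrable_norm_pow (p := 2) two_ne_zero
  have h3 : ∫ v in closedBall 0 (R / 2), ‖f (z + v)‖ ^ 2 =
      ∫ ζ in closedBall z (R / 2), ‖f ζ‖ ^ 2 := by
    have h := (measurePreserving_add_left volume z).setIntegral_preimage_emb
      (measurableEmbedding_addLeft z) (fun ζ => ‖f ζ‖ ^ 2) (closedBall z (R / 2))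
    have h' : (fun v : Cn n => z + v) ⁻¹' closedBall z (R / 2) = closedBall 0 (R / 2) := by
      ext v
      simp
    rwa [h'] at h
  have h4 : ∫ ζ in closedBall z (R / 2), ‖f ζ‖ ^ 2 ≤ ∫ ζ in D, ‖f ζ‖ ^ 2 := by
    refine setIntegral_mono_set h2 (Eventually.of_forall fun ζ => by positivity) ?_
    exact ((closedBall_subset_ball (by linarith)).trans hzD).eventuallyLE
  have h5 : V * ‖f z‖ ^ 2 ≤ ∫ ζ in D, ‖f ζ‖ ^ 2 := by
    calc V * ‖f z‖ ^ 2 = ‖(V : ℂ) * f z ^ 2‖ := by simp [abs_of_pos hV]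
      _ = ‖∫ v in closedBall 0 (R / 2), f (z + v) ^ 2‖ := by rw [h1]
      _ ≤ ∫ v in closedBall 0 (R / 2), ‖f (z + v) ^ 2‖ := norm_integral_le_integral_norm _
      _ = ∫ v in closedBall 0 (R / 2), ‖f (z + v)‖ ^ 2 := by simp only [norm_pow]
      _ ≤ _ := h3.trans_le h4
  rw [inv_mul_eq_div, le_div_iff₀ hV]
  linarith

end MeanValue

/-! ### Regularity and positivity of the Bergman kernel. -/

section Kernel

open Metric Set

variable {n : ℕ} {D : Set (Cn n)} {K : Cn n → Cn n → ℂ}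

/-- Conjugating both argument and value makes the derivative complex-linear again. This converts
antiholomorphy of the kernel in `w` into holomorphy in `conj w`. -/
lemma differentiableOn_conj_comp_star {f : Cn n → ℂ} {U : Set (Cn n)} (hU : IsOpen U)
    (hf : DifferentiableOn ℂ f U) :
    DifferentiableOn ℂ (fun w : Cn n => conj (f (star w))) (star ⁻¹' U) := by
  intro w hw
  have h := (hf.differentiableAt (hU.mem_nhds hw)).hasFDerivAt
  set L := fderiv ℂ f (star w)
  let s : ℂ →L⋆[ℂ] ℂ := (starL ℂ : ℂ ≃L⋆[ℂ] ℂ)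
  let t : Cn n →L⋆[ℂ] Cn n := (starL ℂ : Cn n ≃L⋆[ℂ] Cn n)
  let L' : Cn n →L[ℂ] ℂ := s.comp (L.comp t)
  refine (HasFDerivAt.differentiableAt (f' := L') ?_).differentiableWithinAt
  refine hasFDerivAt_of_restrictScalars ℝ (f' := L')
    (g' := (starL' ℝ : ℂ ≃L[ℝ] ℂ).toContinuousLinearMap ∘L (L.restrictScalars ℝ ∘L
      (starL' ℝ : Cn n ≃L[ℝ] Cn n).toContinuousLinearMap)) ?_ rfl
  have h1 := (h.restrictScalars ℝ).comp w (starL' ℝ : Cn n ≃L[ℝ] Cn n).hasFDerivAt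
  exact (starL' ℝ : ℂ ≃L[ℝ] ℂ).hasFDerivAt.comp w h1

namespace IsBergmanKernel

/-- Reproducing `K(·, w)` at `z` and `K(·, z)` at `w` gives conjugate integrals. -/
lemma conj_symm (hK : IsBergmanKernel D K) {z w : Cn n} (hz : z ∈ D) (hw : w ∈ D) :
    conj (K z w) = K w z := by
  rw [(hK z hz).2.2 (fun ζ => K ζ w) (hK w hw).1 (hK w hw).2.1,
    (hK w hw).2.2 (fun ζ => K ζ z) (hK z hz).1 (hK z hz).2.1, ← integral_conj]
  refine integral_congr_ae (Eventually.of_forall fun ζ => ?_)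
  simp [mul_comm]

lemma apply_self (hK : IsBergmanKernel D K) {w : Cn n} (hw : w ∈ D) :
    K w w = ((∫ ζ in D, ‖K ζ w‖ ^ 2 : ℝ) : ℂ) := by
  rw [(hK w hw).2.2 (fun ζ => K ζ w) (hK w hw).1 (hK w hw).2.1, ← integral_complex_ofReal]
  refine integral_congr_ae (Eventually.of_forall fun ζ => ?_)
  simp [Complex.mul_conj']

/-- If `K(w, w) = 0` then `K(·, w) = 0` a.e., and reproducing the constant `1`, which is in `A²`
because `D` is bounded, would give `1 = 0`. -/
lemma re_apply_self_pos (hK : IsBergmanKernel D K)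
    (hb : Bornology.IsBounded D) {w : Cn n} (hw : w ∈ D) : 0 < (K w w).re := by
  have hfin : IsFiniteMeasure (volume.restrict D) := ⟨by simpa using hb.measure_lt_top⟩
  have h1 := (hK w hw).2.2 (fun _ => 1) (differentiableOn_const _) (memLp_const 1)
  have h2 : K w w ≠ 0 := by
    intro h0
    rw [hK.apply_self hw, Complex.ofReal_eq_zero, integral_eq_zero_iff_of_nonneg
      (fun ζ => by positivity) ((hK w hw).2.1.integrable_norm_pow (p := 2) two_ne_zero)] at h0
    have h3 : ∫ z in D, 1 * conj (K z w) = 0 := by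
      rw [← integral_zero (Cn n) ℂ (μ := volume.restrict D)]
      refine integral_congr_ae ?_
      filter_upwards [h0] with ζ hζ
      simpa using hζ
    rw [h3] at h1
    exact one_ne_zero h1
  rw [hK.apply_self hw] at h2 ⊢
  rw [Complex.ofReal_re]
  refine lt_of_le_of_ne (integral_nonneg fun ζ => by positivity) fun h => h2 ?_
  rw [← h, Complex.ofReal_zero]

/-- With `N = ‖K(·, w)‖²= K(w, w)`, the evaluation bound for `K(·, w)` at `w` itself reads `N² ≤ C
N`, hence `N ≤ C`. -/
lemma exists_integral_norm_sq_le (hK : IsBergmanKernel D K) {c : Cn n} {R : ℝ}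
    (hR : 0 < R) (hsub : ball c (2 * R) ⊆ D) :
    ∃ C : ℝ, ∀ w ∈ ball c R, (∫ ζ in D, ‖K ζ w‖ ^ 2) ≤ C := by
  obtain ⟨C, hC0, hC⟩ := exists_norm_sq_le_integral hR hsub
  refine ⟨C, fun w hw => ?_⟩
  have hwD : w ∈ D := hsub (ball_subset_ball (by linarith) hw)
  have h1 := hC (fun ζ => K ζ w) (hK w hwD).1 (hK w hwD).2.1 w hw
  have h0 : 0 ≤ ∫ ζ in D, ‖K ζ w‖ ^ 2 := integral_nonneg fun ζ => by positivity
  rw [hK.apply_self hwD, Complex.norm_real, Real.norm_of_nonneg h0] at h1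
  by_contra! h
  nlinarith

lemma exists_norm_le_of_mem_ball (hK : IsBergmanKernel D K) {a b : Cn n} {R : ℝ}
    (hR : 0 < R) (ha : ball a (2 * R) ⊆ D) (hb : ball b (2 * R) ⊆ D) :
    ∃ M : ℝ, ∀ z ∈ ball a R, ∀ w ∈ ball b R, ‖K z w‖ ≤ M := by
  obtain ⟨C, hC0, hC⟩ := exists_norm_sq_le_integral hR ha
  obtain ⟨C', hC'⟩ := hK.exists_integral_norm_sq_le hR hb
  refine ⟨√(C * C'), fun z hz w hw => Real.le_sqrt_of_sq_le ?_⟩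
  have hwD : w ∈ D := hb (ball_subset_ball (by linarith) hw)
  exact (hC (fun ζ => K ζ w) (hK w hwD).1 (hK w hwD).2.1 z hz).trans
    (mul_le_mul_of_nonneg_left (hC' w hw) hC0)

/-- The Bergman kernel is jointly holomorphic in `z` and `conj w`. -/
lemma differentiableOn_prod (hK : IsBergmanKernel D K) (hD : IsOpen D) :
    DifferentiableOn ℂ (fun p : Cn n × Cn n => K p.1 (star p.2)) (D ×ˢ (star ⁻¹' D)) := by
  rintro ⟨a, b⟩ ⟨ha, hb⟩
  obtain ⟨r₁, hr₁, h₁⟩ := Metric.isOpen_iff.1 hD a ha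
  obtain ⟨r₂, hr₂, h₂⟩ := Metric.isOpen_iff.1 hD (star b) hb
  set R := min r₁ r₂ / 2
  have hR : 0 < R := by positivity
  have h₁' : ball a (2 * R) ⊆ D :=
    (ball_subset_ball (by linarith [min_le_left r₁ r₂, show R = min r₁ r₂ / 2 from rfl])).trans h₁
  have h₂' : ball (star b) (2 * R) ⊆ D :=
    (ball_subset_ball (by linarith [min_le_right r₁ r₂, show R = min r₁ r₂ / 2 from rfl])).trans h₂
  obtain ⟨M, hM⟩ := hK.exists_norm_le_of_mem_ball hR h₁' h₂'
  have hstar : ∀ w ∈ ball b R, star w ∈ ball (star b) R := by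
    intro w hw
    rw [mem_ball, dist_eq_norm] at hw ⊢
    rwa [← star_sub, norm_star]
  have hbD : ∀ w ∈ ball b R, star w ∈ D := fun w hw =>
    h₂' (ball_subset_ball (by linarith) (hstar w hw))
  have haD : ∀ z ∈ ball a R, z ∈ D := fun z hz => h₁' (ball_subset_ball (by linarith) hz)
  refine (differentiableAt_uncurry_of_separately hR (f := fun z w => K z (star w)) (M := M)
    ?_ ?_ ?_).differentiableWithinAt
  · exact fun w hw => (hK _ (hbD w hw)).1.mono haD
  · intro z hz
    refine ((differentiableOn_conj_comp_star hD (hK z (haD z hz)).1).mono hbD).congr ?_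
    intro w hw
    exact (hK.conj_symm (hbD w hw) (haD z hz)).symm
  · exact fun z hz w hw => hM z hz _ (hstar w hw)

/-- The diagonal `K(w, w)` is the pullback of a jointly holomorphic function along the real-linear
map `w ↦ (w, conj w)`. -/
lemma contDiffOn_log_re_apply_self (hK : IsBergmanKernel D K) (hD : IsOpen D)
    (hb : Bornology.IsBounded D) :
    ContDiffOn ℝ 2 (fun w => ((Real.log (K w w).re : ℝ) : ℂ)) D := by
  have h1 := (contDiffOn_of_differentiableOn (hD.prod (hD.preimage continuous_star))
    (hK.differentiableOn_prod hD) 2).restrict_scalars ℝ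
  have h2 : ContDiff ℝ (2 : ℕ) (fun w : Cn n => (w, star w)) :=
    contDiff_id.prodMk (starL' ℝ : Cn n ≃L[ℝ] Cn n).contDiff
  have h3 : ContDiffOn ℝ (2 : ℕ) (fun w => K w w) D := by
    refine (h1.comp h2.contDiffOn fun w hw => ⟨hw, ?_⟩).congr fun w hw => ?_
    · simpa using hw
    · simp
  have h4 : ContDiffOn ℝ (2 : ℕ) (fun w => (K w w).re) D := Complex.reCLM.contDiff.comp_contDiffOn h3
  have h5 : ContDiffOn ℝ (2 : ℕ) (fun w => Real.log (K w w).re) D :=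
    h4.log fun w hw => (hK.re_apply_self_pos hb hw).ne'
  exact_mod_cast Complex.ofRealCLM.contDiff.comp_contDiffOn h5

end IsBergmanKernel

end Kernel

/-! ### The Bergman space as a Hilbert space; existence of the kernel. -/

section BergmanSpace

open Metric Set

variable {n : ℕ} {D : Set (Cn n)}

/-- The Bergman space `A²(D)` as a subspace of `L²(D)`. -/
def bergmanSpace {n : ℕ} (D : Set (Cn n)) : Submodule ℂ (Lp ℂ 2 (volume.restrict D)) where
  carrier := {f | ∃ g : Cn n → ℂ, DifferentiableOn ℂ g D ∧ f =ᵐ[volume.restrict D] g}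
  add_mem' := by
    rintro f₁ f₂ ⟨g₁, h₁, e₁⟩ ⟨g₂, h₂, e₂⟩
    exact ⟨g₁ + g₂, h₁.add h₂, (Lp.coeFn_add f₁ f₂).trans (e₁.add e₂)⟩
  zero_mem' := ⟨0, differentiableOn_const 0, Lp.coeFn_zero _ _ _⟩
  smul_mem' := by
    rintro a f ⟨g, h, e⟩
    exact ⟨a • g, h.const_smul a, (Lp.coeFn_smul a f).trans (e.const_smul a)⟩

namespace bergmanSpace

/-- The holomorphic representative of an element of the Bergman space. -/
def rep (f : bergmanSpace D) : Cn n → ℂ := f.2.choose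

lemma differentiableOn_rep (f : bergmanSpace D) : DifferentiableOn ℂ (rep f) D :=
  f.2.choose_spec.1

lemma ae_eq_rep (f : bergmanSpace D) :
    (f : Lp ℂ 2 (volume.restrict D)) =ᵐ[volume.restrict D] rep f :=
  f.2.choose_spec.2

lemma memLp_rep (f : bergmanSpace D) : MemLp (rep f) 2 (volume.restrict D) :=
  (memLp_congr_ae (ae_eq_rep f)).1 (Lp.memLp _)

/-- Continuous functions that agree a.e. on an open set agree on it, so on `D` the chosen
representative is canonical, and therefore linear in `f`. -/
lemma eq_rep (hD : IsOpen D) {f : bergmanSpace D} {g : Cn n → ℂ} (hg : DifferentiableOn ℂ g D)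
    (h : (f : Lp ℂ 2 (volume.restrict D)) =ᵐ[volume.restrict D] g) {z : Cn n} (hz : z ∈ D) :
    rep f z = g z :=
  Measure.eqOn_open_of_ae_eq ((ae_eq_rep f).symm.trans h) hD
    (differentiableOn_rep f).continuousOn hg.continuousOn hz

lemma rep_add (hD : IsOpen D) (f g : bergmanSpace D) {z : Cn n} (hz : z ∈ D) :
    rep (f + g) z = rep f z + rep g z :=
  eq_rep hD (g := rep f + rep g) ((differentiableOn_rep f).add (differentiableOn_rep g))
    ((Lp.coeFn_add _ _).trans ((ae_eq_rep f).add (ae_eq_rep g))) hz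

lemma rep_smul (hD : IsOpen D) (a : ℂ) (f : bergmanSpace D) {z : Cn n} (hz : z ∈ D) :
    rep (a • f) z = a * rep f z :=
  eq_rep hD (g := a • rep f) ((differentiableOn_rep f).const_smul a)
    ((Lp.coeFn_smul _ _).trans ((ae_eq_rep f).const_smul a)) hz

lemma inner_eq_integral (f g : bergmanSpace D) :
    inner ℂ f g = ∫ z in D, rep g z * conj (rep f z) := by
  rw [Submodule.coe_inner, L2.inner_def]
  refine integral_congr_ae ?_
  filter_upwards [ae_eq_rep f, ae_eq_rep g] with z hf hg
  rw [hf, hg]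
  simp

lemma integral_norm_rep_sq (f : bergmanSpace D) : ∫ z in D, ‖rep f z‖ ^ 2 = ‖f‖ ^ 2 := by
  have h1 : ((‖f‖ ^ 2 : ℝ) : ℂ) = ((∫ z in D, ‖rep f z‖ ^ 2 : ℝ) : ℂ) := by
    have h := inner_self_eq_norm_sq_to_K (𝕜 := ℂ) f
    rw [inner_eq_integral] at h
    rw [← integral_complex_ofReal]
    push_cast
    refine h.symm.trans (integral_congr_ae (Eventually.of_forall fun z => ?_))
    simp [Complex.mul_conj']
  exact_mod_cast h1.symm

lemma exists_norm_rep_le {c : Cn n} {R : ℝ} (hR : 0 < R) (hsub : ball c (2 * R) ⊆ D) :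
    ∃ C : ℝ, 0 ≤ C ∧ ∀ f : bergmanSpace D, ∀ z ∈ ball c R, ‖rep f z‖ ≤ C * ‖f‖ := by
  obtain ⟨C, hC0, hC⟩ := exists_norm_sq_le_integral hR hsub
  refine ⟨√C, by positivity, fun f z hz => ?_⟩
  have h := hC (rep f) (differentiableOn_rep f) (memLp_rep f) z hz
  rw [integral_norm_rep_sq] at h
  refine le_of_sq_le_sq ?_ (by positivity)
  rwa [mul_pow, Real.sq_sqrt hC0]

lemma exists_ball_two_mul_subset {c : Cn n} (hD : IsOpen D) (hc : c ∈ D) :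
    ∃ R > 0, ball c (2 * R) ⊆ D := by
  obtain ⟨r, hr, h⟩ := Metric.isOpen_iff.1 hD c hc
  exact ⟨r / 2, by positivity, by rwa [mul_div_cancel₀ _ two_ne_zero]⟩

/-- The Bergman space is closed in `L²`. -/
lemma isClosed (hD : IsOpen D) : IsClosed (bergmanSpace D : Set (Lp ℂ 2 (volume.restrict D))) := by
  refine IsSeqClosed.isClosed fun f₀ f hf₀ hf => ?_
  obtain ⟨F, rfl⟩ : ∃ F : ℕ → bergmanSpace D, (fun k => (F k : Lp ℂ 2 (volume.restrict D))) = f₀ :=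
    ⟨fun k => ⟨f₀ k, hf₀ k⟩, rfl⟩
  have hcauchy : CauchySeq F :=
    (Metric.cauchySeq_iff (u := F)).2 fun ε hε => Metric.cauchySeq_iff.1 hf.cauchySeq ε hε
  have hsub : ∀ i j, ∀ z ∈ D, rep (F i) z - rep (F j) z = rep (F i - F j) z := by
    intro i j z hz
    have h := rep_add hD (F i - F j) (F j) hz
    rw [sub_add_cancel] at h
    rw [h]
    ring
  have hloc : ∀ c ∈ D, ∃ R > 0, ∃ C : ℝ, 0 ≤ C ∧ ball c R ⊆ D ∧
      ∀ g : bergmanSpace D, ∀ z ∈ ball c R, ‖rep g z‖ ≤ C * ‖g‖ := by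
    intro c hc
    obtain ⟨R, hR, hRD⟩ := exists_ball_two_mul_subset hD hc
    obtain ⟨C, hC0, hC⟩ := exists_norm_rep_le hR hRD
    exact ⟨R, hR, C, hC0, (ball_subset_ball (by linarith)).trans hRD, hC⟩
  have hdist : ∀ c ∈ D, ∃ R > 0, ball c R ⊆ D ∧
      UniformCauchySeqOn (fun k => rep (F k)) atTop (ball c R) := by
    intro c hc
    obtain ⟨R, hR, C, hC0, hRD, hC⟩ := hloc c hc
    refine ⟨R, hR, hRD, ?_⟩
    rw [Metric.uniformCauchySeqOn_iff]
    intro ε hε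
    obtain ⟨N, hN⟩ := Metric.cauchySeq_iff.1 hcauchy (ε / (C + 1)) (by positivity)
    refine ⟨N, fun i hi j hj z hz => ?_⟩
    have h1 := hN i hi j hj
    rw [dist_eq_norm, lt_div_iff₀ (by positivity)] at h1
    rw [dist_eq_norm, hsub i j z (hRD hz)]
    nlinarith [hC (F i - F j) z hz, norm_nonneg (F i - F j)]
  have hlim : ∀ z : Cn n, ∃ y, z ∈ D → Tendsto (fun k => rep (F k) z) atTop (𝓝 y) := by
    intro z
    by_cases hz : z ∈ D
    · obtain ⟨R, hR, hRD, hC⟩ := hdist z hz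
      obtain ⟨y, hy⟩ := cauchySeq_tendsto_of_complete (hC.cauchySeq (mem_ball_self hR))
      exact ⟨y, fun _ => hy⟩
    · exact ⟨0, fun h => absurd h hz⟩
  choose g hg using hlim
  refine ⟨g, fun c hc => ?_, ?_⟩
  · obtain ⟨R, hR, hRD, hR'⟩ := hdist c hc
    obtain ⟨R₂, hR₂, C, hC0, hRD₂, hC⟩ := hloc c hc
    obtain ⟨B, hB⟩ := hcauchy.isBounded_range.exists_norm_le
    have hmono₁ : ball c (min R R₂) ⊆ ball c R := ball_subset_ball (min_le_left _ _)
    have hmono₂ : ball c (min R R₂) ⊆ ball c R₂ := ball_subset_ball (min_le_right _ _)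
    refine (differentiableAt_of_tendstoUniformlyOn (l := atTop) (f := fun k => rep (F k))
      (R := min R R₂) (M := C * B) (by positivity) ?_ ?_ ?_).differentiableWithinAt
    · exact Eventually.of_forall fun k => (differentiableOn_rep _).mono (hmono₁.trans hRD)
    · refine Eventually.of_forall fun k z hz => (hC (F k) z (hmono₂ hz)).trans ?_
      exact mul_le_mul_of_nonneg_left (hB _ ⟨k, rfl⟩) hC0
    · exact (hR'.mono hmono₁).tendstoUniformlyOn_of_tendsto fun z hz => hg z (hRD (hmono₁ hz))
  -- An a.e. convergent subsequence identifies the `L²` limit with the locally uniform limit `g`.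
  · obtain ⟨ns, hns, hae⟩ := (tendstoInMeasure_of_tendsto_Lp hf).exists_seq_tendsto_ae
    have hrep : ∀ᵐ z ∂volume.restrict D, ∀ k,
        (F k : Lp ℂ 2 (volume.restrict D)) z = rep (F k) z :=
      ae_all_iff.2 fun k => ae_eq_rep (F k)
    filter_upwards [hae, hrep, ae_restrict_mem hD.measurableSet] with z h1 h2 hz
    refine tendsto_nhds_unique h1 (((hg z hz).comp hns.tendsto_atTop).congr fun k => ?_)
    exact (h2 _).symm

end bergmanSpace

/-- Every open set has a Bergman kernel. -/
theorem exists_isBergmanKernel (hD : IsOpen D) : ∃ K, IsBergmanKernel D K := by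
  have : CompleteSpace (bergmanSpace D) := (bergmanSpace.isClosed hD).completeSpace_coe
  have key : ∀ w : Cn n, ∃ k : bergmanSpace D, w ∈ D → ∀ f : bergmanSpace D,
      bergmanSpace.rep f w = inner ℂ k f := by
    intro w
    by_cases hw : w ∈ D
    · obtain ⟨R, hR, hRD⟩ := bergmanSpace.exists_ball_two_mul_subset hD hw
      obtain ⟨C, -, hC⟩ := bergmanSpace.exists_norm_rep_le hR hRD
      let ev : bergmanSpace D →ₗ[ℂ] ℂ :=
        { toFun := fun f => bergmanSpace.rep f w
          map_add' := fun f g => bergmanSpace.rep_add hD f g hw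
          map_smul' := fun a f => bergmanSpace.rep_smul hD a f hw }
      let ev' : StrongDual ℂ (bergmanSpace D) :=
        ev.mkContinuous C fun f => hC f w (mem_ball_self hR)
      -- Riesz representation of the bounded evaluation at `w`.
      refine ⟨(InnerProductSpace.toDual ℂ (bergmanSpace D)).symm ev', fun _ f => ?_⟩
      rw [InnerProductSpace.toDual_symm_apply]
      rfl
    · exact ⟨0, fun h => absurd h hw⟩
  choose k hk using key
  refine ⟨fun z w => bergmanSpace.rep (k w) z, fun w hw => ⟨bergmanSpace.differentiableOn_rep _,
    bergmanSpace.memLp_rep _, fun f hf hf2 => ?_⟩⟩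
  let F : bergmanSpace D := ⟨hf2.toLp f, f, hf, hf2.coeFn_toLp⟩
  have hF : ∀ z ∈ D, bergmanSpace.rep F z = f z := fun z hz =>
    bergmanSpace.eq_rep hD hf hf2.coeFn_toLp hz
  rw [← hF w hw, hk w hw F, bergmanSpace.inner_eq_integral]
  exact setIntegral_congr_fun hD.measurableSet fun z hz => by simp only [hF z hz]

end BergmanSpace

/-! ### Local comparison of the Bergman and Euclidean metrics. -/

section BergmanMetric

open Metric Set

variable {n : ℕ} {D : Set (Cn n)}

lemma isBergmanKernel_bergmanKernel (hD : IsOpen D) : IsBergmanKernel D (bergmanKernel D) := by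
  have h := exists_isBergmanKernel hD
  rw [bergmanKernel, dif_pos h]
  exact h.choose_spec

lemma continuousOn_bergmanCoeff (hD : IsOpen D) (hb : Bornology.IsBounded D) (j k : Fin n) :
    ContinuousOn (bergmanCoeff D j k) D := by
  have hG := (isBergmanKernel_bergmanKernel hD).contDiffOn_log_re_apply_self hD hb
  have h1 : ContDiffOn ℝ 1
      (wirtingerBar k fun w => ((Real.log (bergmanKernel D w w).re : ℝ) : ℂ)) D := by
    have h2 := hG.fderiv_of_isOpen hD (m := 1) (by norm_num)
    exact contDiffOn_const.mul ((h2.clm_apply contDiffOn_const).add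
      (contDiffOn_const.mul (h2.clm_apply contDiffOn_const)))
  have h2 := h1.continuousOn_fderiv_of_isOpen hD le_rfl
  exact continuousOn_const.mul ((h2.clm_apply continuousOn_const).sub
    (continuousOn_const.mul (h2.clm_apply continuousOn_const)))

/-- The Bergman metric is locally bounded by the Euclidean one. -/
lemma exists_bergmanLength_le (hD : IsOpen D) (hb : Bornology.IsBounded D) {c : Cn n}
    (hc : c ∈ D) : ∃ R > 0, ∃ M, 0 ≤ M ∧ ball c R ⊆ D ∧
      ∀ z ∈ ball c R, ∀ u, bergmanLength D z u ≤ M * ‖u‖ := by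
  obtain ⟨R, hR, M, hsub, hM⟩ := exists_ball_subset_norm_le (f := fun z =>
    (fun j k => bergmanCoeff D j k z : Fin n → Fin n → ℂ)) hD
    (continuousOn_pi.2 fun j => continuousOn_pi.2 fun k => continuousOn_bergmanCoeff hD hb j k) hc
  have hM0 : 0 ≤ M := (norm_nonneg _).trans (hM c (mem_ball_self hR))
  refine ⟨R, hR, √(n * n * M), by positivity, hsub, fun z hz u => ?_⟩
  have h1 : ‖bergmanMetric D z u u‖ ≤ n * n * M * ‖u‖ ^ 2 := by
    have h2 : ∀ j k, ‖bergmanCoeff D j k z * u j * conj (u k)‖ ≤ M * ‖u‖ ^ 2 := by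
      intro j k
      have h3 : ‖bergmanCoeff D j k z‖ ≤ M :=
        ((norm_le_pi_norm (fun k => bergmanCoeff D j k z) k).trans
          (norm_le_pi_norm (fun j k => bergmanCoeff D j k z : Fin n → Fin n → ℂ) j)).trans (hM z hz)
      rw [norm_mul, norm_mul, RCLike.norm_conj, mul_assoc, sq]
      gcongr
      · exact norm_le_pi_norm u j
      · exact norm_le_pi_norm u k
    calc ‖bergmanMetric D z u u‖ ≤ ∑ j, ‖∑ k, bergmanCoeff D j k z * u j * conj (u k)‖ :=
          norm_sum_le _ _
      _ ≤ ∑ j : Fin n, ∑ k : Fin n, M * ‖u‖ ^ 2 :=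
          Finset.sum_le_sum fun j _ => (norm_sum_le _ _).trans (Finset.sum_le_sum fun k _ => h2 j k)
      _ = _ := by simp; ring
  rw [bergmanLength]
  refine (Real.sqrt_le_sqrt (((Complex.re_le_norm _).trans h1))).trans_eq ?_
  rw [Real.sqrt_mul (by positivity), Real.sqrt_sq (norm_nonneg u)]

end BergmanMetric

open Metric Set

variable {n : ℕ}

section ZeroExt

variable {D : Set (Cn n)}

lemma zeroExt_eqOn {F : Type*} [Zero F] (g : Cn n → F) :
    EqOn (zeroExt fun z : D => g z) g D := fun z hz => zeroExt_apply _ (⟨z, hz⟩ : D)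

lemma zeroExt_eventuallyEq {F : Type*} [Zero F] (hD : IsOpen D) (g : Cn n → F) {z : Cn n}
    (hz : z ∈ D) : zeroExt (fun z : D => g z) =ᶠ[𝓝 z] g :=
  (zeroExt_eqOn g).eventuallyEq_of_mem (hD.mem_nhds hz)

end ZeroExt

variable {D : BoundedHomogeneousDomain n}

/-! ### Local bounds and growth of Bloch functions. -/

namespace BlochSpace

lemma blochBeta_le_norm (f : BlochSpace D) : (blochBeta f.toFun).toReal ≤ ‖f‖ := by
  rw [norm_def]
  linarith [norm_nonneg (f ⟨0, D.zero_mem⟩)]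

lemma norm_apply_zero_le (f : BlochSpace D) : ‖f ⟨0, D.zero_mem⟩‖ ≤ ‖f‖ := by
  rw [norm_def]
  linarith [ENNReal.toReal_nonneg (a := blochBeta f.toFun)]

lemma norm_fderiv_apply_le (f : BlochSpace D) {z : Cn n} (hz : z ∈ D.carrier) (u : Cn n) :
    ‖fderiv ℂ (zeroExt f.toFun) z u‖ ≤
      (blochBeta f.toFun).toReal * bergmanLength D.carrier z u := by
  have hL : 0 ≤ bergmanLength D.carrier z u := Real.sqrt_nonneg _
  have h1 := enorm_fderiv_div_le_blochBeta f.toFun ⟨z, hz⟩ u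
  have h2 : ‖fderiv ℂ (zeroExt f.toFun) z u‖ₑ ≤
      blochBeta f.toFun * ENNReal.ofReal (bergmanLength D.carrier z u) := by
    -- On a vector of length zero a nonzero derivative would make the quotient infinite,
    -- contradicting `β_f < ∞`; definiteness of the metric is not needed.
    rcases eq_or_ne (ENNReal.ofReal (bergmanLength D.carrier z u)) 0 with h0 | h0
    · by_contra! h3
      have h4 : ‖fderiv ℂ (zeroExt f.toFun) z u‖ₑ ≠ 0 := (bot_le.trans_lt h3).ne'
      rw [h0, ENNReal.div_zero h4, top_le_iff] at h1
      exact f.blochBeta_lt_top.ne h1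
    · exact (ENNReal.div_le_iff h0 ENNReal.ofReal_ne_top).1 h1
  have h3 := ENNReal.toReal_mono
    (ENNReal.mul_lt_top f.blochBeta_lt_top ENNReal.ofReal_lt_top).ne h2
  rwa [toReal_enorm, ENNReal.toReal_mul, ENNReal.toReal_ofReal hL] at h3

lemma differentiableOn_zeroExt (f : BlochSpace D) :
    DifferentiableOn ℂ (zeroExt f.toFun) D.carrier := f.isHolomorphic

lemma exists_norm_fderiv_le {c : Cn n} (hc : c ∈ D.carrier) :
    ∃ R > 0, ∃ C, 0 ≤ C ∧ ball c R ⊆ D.carrier ∧ ∀ f : BlochSpace D, ∀ z ∈ ball c R,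
      ‖fderiv ℂ (zeroExt f.toFun) z‖ ≤ C * ‖f‖ := by
  obtain ⟨R, hR, C, hC0, hsub, hC⟩ := exists_bergmanLength_le D.isOpen D.isBounded hc
  refine ⟨R, hR, C, hC0, hsub, fun f z hz => ?_⟩
  refine ContinuousLinearMap.opNorm_le_bound _ (by positivity) fun u => ?_
  calc _ ≤ (blochBeta f.toFun).toReal * bergmanLength D.carrier z u :=
        f.norm_fderiv_apply_le (hsub hz) u
    _ ≤ ‖f‖ * (C * ‖u‖) :=
        mul_le_mul f.blochBeta_le_norm (hC z hz u) (Real.sqrt_nonneg _) (norm_nonneg f)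
    _ = _ := by ring

lemma exists_norm_sub_le {c : Cn n} (hc : c ∈ D.carrier) :
    ∃ R > 0, ∃ C, 0 ≤ C ∧ ball c R ⊆ D.carrier ∧ ∀ f : BlochSpace D, ∀ z ∈ ball c R,
      ∀ w ∈ ball c R, ‖zeroExt f.toFun z - zeroExt f.toFun w‖ ≤ C * ‖f‖ * ‖z - w‖ := by
  obtain ⟨R, hR, C, hC0, hsub, hC⟩ := exists_norm_fderiv_le hc
  refine ⟨R, hR, C, hC0, hsub, fun f z hz w hw => ?_⟩
  exact (convex_ball c R).norm_image_sub_le_of_norm_fderiv_le (𝕜 := ℂ)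
    (fun x hx => f.differentiableOn_zeroExt.differentiableAt (D.isOpen.mem_nhds (hsub hx)))
    (hC f) hw hz

/-- Point evaluations are bounded on the Bloch space. -/
lemma exists_norm_apply_le (z : D.carrier) :
    ∃ C, 0 ≤ C ∧ ∀ f : BlochSpace D, ‖f z‖ ≤ C * ‖f‖ := by
  have : PreconnectedSpace D.carrier :=
    isPreconnected_iff_preconnectedSpace.1 D.isConnected.isPreconnected
  -- Boundedness of evaluation passes between points of a small ball, so `P` is locally constant; it
  -- holds at `0`, hence everywhere by connectedness.
  let P : D.carrier → Prop := fun z => ∃ C, 0 ≤ C ∧ ∀ f : BlochSpace D, ‖f z‖ ≤ C * ‖f‖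
  have hP : IsLocallyConstant P := by
    refine (IsLocallyConstant.iff_eventually_eq P).2 fun c => ?_
    obtain ⟨R, hR, C, hC0, hsub, hC⟩ := exists_norm_sub_le c.2
    have hmem : ∀ᶠ w : D.carrier in 𝓝 c, (w : Cn n) ∈ ball (c : Cn n) R :=
      continuous_subtype_val.continuousAt.eventually (ball_mem_nhds _ hR)
    have step : ∀ a b : D.carrier, (a : Cn n) ∈ ball (c : Cn n) R →
        (b : Cn n) ∈ ball (c : Cn n) R → P a → P b := by
      rintro a b ha hb ⟨A, hA0, hA⟩
      refine ⟨C * ‖(b : Cn n) - a‖ + A, by positivity, fun f => ?_⟩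
      have h1 := hC f b hb a ha
      rw [zeroExt_apply, zeroExt_apply] at h1
      have h2 := norm_le_norm_sub_add (f b) (f a)
      have h3 := hA f
      linarith
    filter_upwards [hmem] with w hw
    exact propext ⟨step w c hw (mem_ball_self hR), step c w (mem_ball_self hR) hw⟩
  have h0 : P ⟨0, D.zero_mem⟩ := ⟨1, zero_le_one, fun f => by simpa using f.norm_apply_zero_le⟩
  rwa [hP.apply_eq_of_preconnectedSpace ⟨0, D.zero_mem⟩ z] at h0

lemma exists_norm_le_ball {c : Cn n} (hc : c ∈ D.carrier) :
    ∃ R > 0, ∃ C, 0 ≤ C ∧ ball c R ⊆ D.carrier ∧ ∀ f : BlochSpace D, ∀ z ∈ ball c R,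
      ‖zeroExt f.toFun z‖ ≤ C * ‖f‖ := by
  obtain ⟨R, hR, C, hC0, hsub, hC⟩ := exists_norm_sub_le hc
  obtain ⟨A, hA0, hA⟩ := exists_norm_apply_le ⟨c, hc⟩
  refine ⟨R, hR, C * R + A, by positivity, hsub, fun f z hz => ?_⟩
  have h1 := hC f z hz c (mem_ball_self hR)
  have h2 := hA f
  rw [← zeroExt_apply f.toFun] at h2
  have h3 : ‖z - c‖ ≤ R := by simpa [dist_eq_norm] using (mem_ball.1 hz).le
  have h4 : C * ‖f‖ * ‖z - c‖ ≤ C * ‖f‖ * R := by gcongr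
  linarith [norm_le_norm_sub_add (zeroExt f.toFun z) (zeroExt f.toFun c)]

lemma exists_norm_le_of_isCompact {S : Set (Cn n)} (hS : IsCompact S) (hSD : S ⊆ D.carrier) :
    ∃ C, 0 ≤ C ∧ ∀ f : BlochSpace D, ∀ z ∈ S, ‖zeroExt f.toFun z‖ ≤ C * ‖f‖ := by
  refine hS.induction_on (p := fun S => ∃ C, 0 ≤ C ∧ ∀ f : BlochSpace D, ∀ z ∈ S,
    ‖zeroExt f.toFun z‖ ≤ C * ‖f‖) ⟨0, le_rfl, by simp⟩ ?_ ?_ ?_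
  · rintro s t hst ⟨C, hC0, hC⟩
    exact ⟨C, hC0, fun f z hz => hC f z (hst hz)⟩
  · rintro s t ⟨C, hC0, hC⟩ ⟨C', hC0', hC'⟩
    refine ⟨max C C', hC0.trans (le_max_left _ _), ?_⟩
    rintro f z (hz | hz)
    · exact (hC f z hz).trans (by gcongr; exact le_max_left _ _)
    · exact (hC' f z hz).trans (by gcongr; exact le_max_right _ _)
  · intro c hc
    obtain ⟨R, hR, C, hC0, -, hC⟩ := exists_norm_le_ball (hSD hc)
    exact ⟨ball c R, mem_nhdsWithin_of_mem_nhds (ball_mem_nhds c hR), C, hC0, hC⟩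

/-- The constant function `1` as an element of the Bloch space. -/
def one : BlochSpace D :=
  ⟨fun _ => 1, (differentiableOn_const 1).congr (zeroExt_eqOn fun _ => 1), by
    refine (blochBeta_le (c := 0) fun z u => ?_).trans_lt ENNReal.zero_lt_top
    rw [(zeroExt_eventuallyEq D.isOpen (fun _ => (1 : ℂ)) z.2).fderiv_eq]
    simp⟩

lemma one_apply (z : D.carrier) : (one : BlochSpace D) z = 1 := rfl

lemma blochBeta_one : blochBeta (one : BlochSpace D).toFun = 0 := by
  refine le_antisymm (blochBeta_le fun z u => ?_) bot_le
  have h : zeroExt (one : BlochSpace D).toFun =ᶠ[𝓝 (z : Cn n)] fun _ => (1 : ℂ) :=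
    zeroExt_eventuallyEq D.isOpen (fun _ => (1 : ℂ)) z.2
  rw [h.fderiv_eq]
  simp

/-- Subtracting `f 0` removes the first term of the norm and does not increase `β_f`. -/
lemma norm_add_smul_one_le (f : BlochSpace D) :
    ‖f + (-f ⟨0, D.zero_mem⟩) • (one : BlochSpace D)‖ ≤ ‖f‖ := by
  refine le_trans ?_ f.blochBeta_le_norm
  rw [norm_def, toFun_add, toFun_smul]
  have h1 : blochBeta (f.toFun + (-f ⟨0, D.zero_mem⟩) • (one : BlochSpace D).toFun) ≤
      blochBeta f.toFun := by
    refine (blochBeta_add_le D.isOpen f.isHolomorphic (one.isHolomorphic.smul _)).trans ?_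
    rw [blochBeta_smul D.isOpen _ one.isHolomorphic, blochBeta_one, mul_zero, add_zero]
  have h2 := ENNReal.toReal_mono f.blochBeta_lt_top.ne h1
  simpa [one_apply] using h2

lemma enorm_le_omega_of_apply_zero {f : BlochSpace D} (hf : f ⟨0, D.zero_mem⟩ = 0)
    (z : D.carrier) : ‖f z‖ₑ ≤ ‖f‖ₑ * omega D z := by
  rcases eq_or_ne f 0 with rfl | h
  · simp [toFun_zero]
  have hn : ‖f‖ ≠ 0 := norm_ne_zero_iff.2 h
  set a : ℂ := ((‖f‖⁻¹ : ℝ) : ℂ)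
  have ha : ‖a‖ = ‖f‖⁻¹ := by simp [a]
  have h1 : ‖(a • f) z‖ₑ ≤ omega D z := by
    refine le_iSup₂ (f := fun (g : BlochSpace D)
      (_ : g ⟨0, D.zero_mem⟩ = 0 ∧ ‖g‖ ≤ 1) => ‖g z‖ₑ) (a • f) ⟨?_, ?_⟩
    · rw [toFun_smul, Pi.smul_apply, hf, smul_zero]
    · rw [norm_smul, ha, inv_mul_cancel₀ hn]
  have h2 : f z = (‖f‖ : ℂ) * (a • f) z := by
    rw [toFun_smul, Pi.smul_apply, smul_eq_mul, ← mul_assoc]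
    simp [a, hn]
  calc ‖f z‖ₑ = ‖f‖ₑ * ‖(a • f) z‖ₑ := by
        conv_lhs => rw [h2, enorm_mul]
        congr 1
        simp [← ofReal_norm]
    _ ≤ _ := by gcongr

/-- The growth estimate through which `ω` enters the proof. It is stated in `[0, ∞]`, so finiteness
of `ω` plays no role. -/
lemma enorm_le_omega (f : BlochSpace D) (z : D.carrier) :
    ‖f z‖ₑ ≤ ‖f ⟨0, D.zero_mem⟩‖ₑ + ‖f‖ₑ * omega D z := by
  set h := f + (-f ⟨0, D.zero_mem⟩) • (one : BlochSpace D) with hh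
  have hz : ∀ w, h w = f w - f ⟨0, D.zero_mem⟩ := by
    intro w
    rw [hh, toFun_add, toFun_smul]
    simp [one_apply, sub_eq_add_neg]
  have h1 := enorm_le_omega_of_apply_zero (f := h) (by rw [hz, sub_self]) z
  have h2 : ‖h‖ₑ ≤ ‖f‖ₑ := by
    rw [← ofReal_norm, ← ofReal_norm]
    exact ENNReal.ofReal_le_ofReal f.norm_add_smul_one_le
  have h3 : f z = f ⟨0, D.zero_mem⟩ + h z := by rw [hz]; ring
  calc ‖f z‖ₑ ≤ ‖f ⟨0, D.zero_mem⟩‖ₑ + ‖h z‖ₑ := by rw [h3]; exact enorm_add_le _ _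
    _ ≤ _ := by gcongr; exact h1.trans (by gcongr)

end BlochSpace

/-! ### Compactness of the Bloch unit ball for pointwise convergence. -/

lemma exists_tendsto_of_norm_le {ι X : Type*} [NormedAddCommGroup X] [ProperSpace X]
    (l : Ultrafilter ι) {f : ι → X} {C : ℝ} (h : ∀ᶠ i in (l : Filter ι), ‖f i‖ ≤ C) :
    ∃ y, Tendsto f l (𝓝 y) := by
  obtain ⟨y, -, hy⟩ := (isCompact_closedBall (0 : X) C).ultrafilter_le_nhds (l.map f)
    (tendsto_principal.2 (h.mono fun i hi => by simpa using hi))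
  exact ⟨y, hy⟩

namespace BlochSpace

/-- The closed unit ball of the Bloch space is compact for pointwise convergence. -/
lemma exists_tendsto_apply (l : Ultrafilter (BlochSpace D))
    (hl : ∀ᶠ f in (l : Filter (BlochSpace D)), ‖f‖ ≤ 1) :
    ∃ g : BlochSpace D, ‖g‖ ≤ 1 ∧
      ∀ z ∈ D.carrier, Tendsto (fun f : BlochSpace D => zeroExt f.toFun z) l
        (𝓝 (zeroExt g.toFun z)) := by
  have hlim : ∀ z : Cn n, ∃ y, z ∈ D.carrier →
      Tendsto (fun f : BlochSpace D => zeroExt f.toFun z) l (𝓝 y) := by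
    intro z
    by_cases hz : z ∈ D.carrier
    · obtain ⟨C, hC0, hC⟩ := exists_norm_apply_le ⟨z, hz⟩
      obtain ⟨y, hy⟩ := exists_tendsto_of_norm_le l
        (f := fun f : BlochSpace D => zeroExt f.toFun z) (C := C) (by
          filter_upwards [hl] with f hf
          rw [zeroExt_apply f.toFun ⟨z, hz⟩]
          exact (hC f).trans (mul_le_of_le_one_right hC0 hf))
      exact ⟨y, fun _ => hy⟩
    · exact ⟨0, fun h => absurd h hz⟩
  choose g hg using hlim
  -- The derivatives are bounded in a finite-dimensional space, so they too converge along the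
  -- ultrafilter, and their limit is the derivative of `g`.
  have hderiv : ∀ z ∈ D.carrier, ∃ L : Cn n →L[ℂ] ℂ, HasFDerivAt g L z ∧
      Tendsto (fun f : BlochSpace D => fderiv ℂ (zeroExt f.toFun) z) l (𝓝 L) := by
    intro z hz
    have : ProperSpace (Cn n →L[ℂ] ℂ) := FiniteDimensional.proper ℂ _
    obtain ⟨R, hR, C, hC0, -, hC⟩ := exists_norm_fderiv_le hz
    obtain ⟨R', hR', C', hC0', hsub, hC'⟩ := exists_norm_le_ball hz
    obtain ⟨L, hL⟩ := exists_tendsto_of_norm_le l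
      (f := fun f : BlochSpace D => fderiv ℂ (zeroExt f.toFun) z) (C := C) (by
        filter_upwards [hl] with f hf
        exact (hC f z (mem_ball_self hR)).trans (mul_le_of_le_one_right hC0 hf))
    refine ⟨L, hasFDerivAt_of_tendsto_of_norm_le hR' (M := C')
      (Eventually.of_forall fun f => f.differentiableOn_zeroExt.mono hsub) ?_
      (fun w hw => hg w (hsub hw)) hL, hL⟩
    filter_upwards [hl] with f hf w hw
    exact (hC' f w hw).trans (mul_le_of_le_one_right hC0' hf)
  have hg0 : ‖g 0‖ ≤ 1 := by
    refine le_of_tendsto (hg 0 D.zero_mem).norm ?_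
    filter_upwards [hl] with f hf
    rw [zeroExt_apply f.toFun ⟨0, D.zero_mem⟩]
    exact f.norm_apply_zero_le.trans hf
  -- Keeping `1 - ‖g 0‖` instead of `1` is what gives `‖g‖ ≤ 1`: both terms of the norm share one
  -- budget.
  have hbound : ∀ z ∈ D.carrier, ∀ u,
      ‖fderiv ℂ g z u‖ ≤ (1 - ‖g 0‖) * bergmanLength D.carrier z u := by
    intro z hz u
    obtain ⟨L, hL, hlL⟩ := hderiv z hz
    rw [hL.fderiv]
    have h1 : Tendsto (fun f : BlochSpace D => ‖fderiv ℂ (zeroExt f.toFun) z u‖) l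
        (𝓝 ‖L u‖) :=
      (((ContinuousLinearMap.apply ℂ ℂ u).continuous.tendsto L).comp hlL).norm
    have h2 : Tendsto (fun f : BlochSpace D =>
        (1 - ‖zeroExt f.toFun 0‖) * bergmanLength D.carrier z u) l
        (𝓝 ((1 - ‖g 0‖) * bergmanLength D.carrier z u)) :=
      ((hg 0 D.zero_mem).norm.const_sub 1).mul_const _
    refine le_of_tendsto_of_tendsto h1 h2 ?_
    filter_upwards [hl] with f hf
    refine (f.norm_fderiv_apply_le hz u).trans
      (mul_le_mul_of_nonneg_right ?_ (Real.sqrt_nonneg _))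
    rw [zeroExt_apply f.toFun ⟨0, D.zero_mem⟩]
    rw [norm_def] at hf
    linarith
  have hbeta : blochBeta (fun z : D.carrier => g z) ≤ ENNReal.ofReal (1 - ‖g 0‖) := by
    refine blochBeta_le fun z u => ENNReal.div_le_of_le_mul ?_
    rw [(zeroExt_eventuallyEq D.isOpen g z.2).fderiv_eq, ← ofReal_norm,
      ← ENNReal.ofReal_mul (by linarith)]
    exact ENNReal.ofReal_le_ofReal (hbound z z.2 u)
  have hhol : IsHolomorphic (fun z : D.carrier => g z) := by
    refine DifferentiableOn.congr (fun z hz => ?_) (zeroExt_eqOn g)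
    obtain ⟨L, hL, -⟩ := hderiv z hz
    exact hL.differentiableAt.differentiableWithinAt
  refine ⟨⟨fun z => g z, hhol, hbeta.trans_lt ENNReal.ofReal_lt_top⟩, ?_, fun z hz => ?_⟩
  · have h1 := ENNReal.toReal_mono ENNReal.ofReal_ne_top hbeta
    rw [ENNReal.toReal_ofReal (by linarith)] at h1
    change ‖g 0‖ + (blochBeta (fun z : D.carrier => g z)).toReal ≤ 1
    linarith
  · have h1 : zeroExt (fun z : D.carrier => g z) z = g z := zeroExt_eqOn g hz
    change Tendsto _ _ (𝓝 (zeroExt (fun z : D.carrier => g z) z))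
    rw [h1]
    exact hg z hz

/-- On the unit ball of the Bloch space, pointwise convergence is uniform on compact sets. -/
lemma eventually_norm_sub_le {l : Filter (BlochSpace D)} (hl : ∀ᶠ f in l, ‖f‖ ≤ 1)
    {g : BlochSpace D} (hg1 : ‖g‖ ≤ 1)
    (hg : ∀ z ∈ D.carrier, Tendsto (fun f : BlochSpace D => zeroExt f.toFun z) l
      (𝓝 (zeroExt g.toFun z))) {S : Set (Cn n)} (hS : IsCompact S) (hSD : S ⊆ D.carrier)
    {ε : ℝ} (hε : 0 < ε) :
    ∀ᶠ f in l, ∀ z ∈ S, ‖zeroExt f.toFun z - zeroExt g.toFun z‖ ≤ ε := by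
  refine hS.induction_on (p := fun S => ∀ᶠ f in l, ∀ z ∈ S,
    ‖zeroExt f.toFun z - zeroExt g.toFun z‖ ≤ ε) (by simp) ?_ ?_ ?_
  · exact fun s t hst h => h.mono fun f hf z hz => hf z (hst hz)
  · intro s t hs ht
    filter_upwards [hs, ht] with f h1 h2 z hz
    exact hz.elim (h1 z) (h2 z)
  · intro c hc
    obtain ⟨R, hR, C, hC0, -, hC⟩ := exists_norm_sub_le (hSD hc)
    -- Within radius `r` every function of the unit ball varies by at most `ε / 3`; `C + 1` avoids
    -- division by zero.
    set r := min R (ε / (3 * (C + 1)))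
    have hr : 0 < r := by positivity
    refine ⟨ball c r, mem_nhdsWithin_of_mem_nhds (ball_mem_nhds c hr), ?_⟩
    have h1 := Metric.tendsto_nhds.1 (hg c (hSD hc)) (ε / 3) (by positivity)
    filter_upwards [hl, h1] with f hf hfc z hz
    have hzR : z ∈ ball c R := ball_subset_ball (min_le_left _ _) hz
    have hzr : ‖z - c‖ ≤ ε / (3 * (C + 1)) := by
      rw [mem_ball, dist_eq_norm] at hz
      exact hz.le.trans (min_le_right _ _)
    have key : ∀ h : BlochSpace D, ‖h‖ ≤ 1 →
        ‖zeroExt h.toFun z - zeroExt h.toFun c‖ ≤ ε / 3 := by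
      intro h hh
      calc _ ≤ C * ‖h‖ * ‖z - c‖ := hC h z hzR c (mem_ball_self hR)
        _ ≤ (C + 1) * 1 * (ε / (3 * (C + 1))) := by gcongr; linarith
        _ = ε / 3 := by field_simp
    rw [dist_eq_norm] at hfc
    have h2 := key f hf
    have h3 := key g hg1
    have h4 : zeroExt f.toFun z - zeroExt g.toFun z =
        (zeroExt f.toFun z - zeroExt f.toFun c) + (zeroExt f.toFun c - zeroExt g.toFun c) -
          (zeroExt g.toFun z - zeroExt g.toFun c) := by ring
    rw [h4]
    refine (norm_sub_le _ _).trans ?_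
    linarith [norm_add_le (zeroExt f.toFun z - zeroExt f.toFun c)
      (zeroExt f.toFun c - zeroExt g.toFun c)]

end BlochSpace

/-! ### The weighted composition operator. -/

section Operator

variable {μ : Weight D} {ψ : D.carrier → ℂ} {φ : D.carrier → D.carrier}

/-- Off a compact subset of `D`, the weighted composition is controlled by the value at `0`. -/
lemma exists_isCompact_weighted_le
    (hlim : Tendsto
      (fun z : D.carrier => ENNReal.ofReal (1 / 2 * μ z * ‖ψ z‖) * omega D (φ z))
      (comap (fun z : D.carrier => (φ z : Cn n)) (𝓝ˢ (frontier D.carrier))) (𝓝 0))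
    {ε : ℝ} (hε : 0 < ε) :
    ∃ S : Set (Cn n), IsCompact S ∧ S ⊆ D.carrier ∧ ∀ z : D.carrier, (φ z : Cn n) ∉ S →
      ∀ f : BlochSpace D, μ z * ‖ψ z * f (φ z)‖ ≤
        μ z * ‖ψ z‖ * ‖f ⟨0, D.zero_mem⟩‖ + ε * ‖f‖ := by
  have h1 : ∀ᶠ z in comap (fun z : D.carrier => (φ z : Cn n)) (𝓝ˢ (frontier D.carrier)),
      ENNReal.ofReal (1 / 2 * μ z * ‖ψ z‖) * omega D (φ z) < ENNReal.ofReal (ε / 2) :=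
    hlim.eventually_lt_const (ENNReal.ofReal_pos.2 (by positivity))
  obtain ⟨V, hV, hVz⟩ := h1
  rw [mem_nhdsSet_iff_exists] at hV
  obtain ⟨U, hU, hfU, hUV⟩ := hV
  -- Closed and bounded, hence compact; it lies in `D` because `U` covers the frontier.
  refine ⟨closure D.carrier \ U, D.isBounded.isCompact_closure.diff hU, ?_, ?_⟩
  · rintro z ⟨hz, hzU⟩
    by_contra hzD
    refine hzU (hfU ⟨hz, ?_⟩)
    rwa [D.isOpen.interior_eq]
  · intro z hz f
    have hzU : (φ z : Cn n) ∈ U := by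
      by_contra h
      exact hz ⟨subset_closure (φ z).2, h⟩
    have h2 : ENNReal.ofReal (1 / 2 * μ z * ‖ψ z‖) * omega D (φ z) < ENNReal.ofReal (ε / 2) :=
      hVz (hUV hzU)
    have hm : 0 ≤ 1 / 2 * μ z * ‖ψ z‖ := by have := (μ.pos z).le; positivity
    have h3 : ENNReal.ofReal (1 / 2 * μ z * ‖ψ z‖ * ‖f (φ z)‖) ≤ ENNReal.ofReal
        (1 / 2 * μ z * ‖ψ z‖ * ‖f ⟨0, D.zero_mem⟩‖ + ‖f‖ * (ε / 2)) := by
      rw [ENNReal.ofReal_add (by positivity) (by positivity), ENNReal.ofReal_mul hm,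
        ENNReal.ofReal_mul hm, ENNReal.ofReal_mul (norm_nonneg f), ofReal_norm, ofReal_norm,
        ofReal_norm]
      calc _ ≤ ENNReal.ofReal (1 / 2 * μ z * ‖ψ z‖) *
            (‖f ⟨0, D.zero_mem⟩‖ₑ + ‖f‖ₑ * omega D (φ z)) := by
              gcongr
              exact f.enorm_le_omega (φ z)
        _ = ENNReal.ofReal (1 / 2 * μ z * ‖ψ z‖) * ‖f ⟨0, D.zero_mem⟩‖ₑ +
            ‖f‖ₑ * (ENNReal.ofReal (1 / 2 * μ z * ‖ψ z‖) * omega D (φ z)) := by ring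
        _ ≤ _ := by gcongr
    rw [ENNReal.ofReal_le_ofReal_iff (by positivity)] at h3
    rw [norm_mul]
    linarith

lemma isHolomorphic_weightedComposition (hψ : IsHolomorphic ψ)
    (hφ : IsHolomorphic (fun z => (φ z : Cn n))) {f : D.carrier → ℂ} (hf : IsHolomorphic f) :
    IsHolomorphic (fun z => ψ z * f (φ z)) := by
  have hφD : ∀ z ∈ D.carrier, zeroExt (fun z => (φ z : Cn n)) z ∈ D.carrier := by
    intro z hz
    rw [zeroExt_apply (fun z => (φ z : Cn n)) ⟨z, hz⟩]
    exact (φ _).2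
  refine (DifferentiableOn.mul hψ (DifferentiableOn.comp hf hφ hφD)).congr fun z hz => ?_
  have h1 := zeroExt_apply (fun z => ψ z * f (φ z)) ⟨z, hz⟩
  have h2 := zeroExt_apply ψ ⟨z, hz⟩
  have h3 := zeroExt_apply (fun z => (φ z : Cn n)) ⟨z, hz⟩
  simp only at h1 h2 h3
  rw [Pi.mul_apply, Function.comp_apply, h1, h2, h3, zeroExt_apply]

/-- The weighted composition operator `W_{ψ,φ}` between function spaces. -/
lemma exists_weightedComposition (hφ : IsHolomorphic (fun z => (φ z : Cn n)))
    (hψ : ψ ∈ hInfSubmodule D μ) {C : ℝ}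
    (hC : ∀ (f : BlochSpace D) (z : D.carrier), μ z * ‖ψ z * f (φ z)‖ ≤ C * ‖f‖) :
    ∃ W : BlochSpace D →L[ℂ] HInf D μ,
      ∀ (f : BlochSpace D) (z : D.carrier), W f z = ψ z * f (φ z) := by
  have : Nonempty D.carrier := ⟨⟨0, D.zero_mem⟩⟩
  let W : BlochSpace D →ₗ[ℂ] HInf D μ :=
    { toFun := fun f => ⟨fun z => ψ z * f (φ z),
        isHolomorphic_weightedComposition hψ.1 hφ f.isHolomorphic, C * ‖f‖, by
          rintro _ ⟨z, rfl⟩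
          exact hC f z⟩
      map_add' := fun f g => HInf.toFun_injective (funext fun z => mul_add _ _ _)
      map_smul' := fun a f => HInf.toFun_injective (funext fun z => mul_left_comm _ _ _) }
  exact ⟨W.mkContinuous C fun f => ciSup_le fun z => hC f z, fun f z => rfl⟩

end Operator

end BlochWCO
end

open BlochWCO in
theorem mainTheorem4 (n : ℕ) (D : BlochWCO.BoundedHomogeneousDomain n) (μ : BlochWCO.Weight D)
    (ψ : D.carrier → ℂ) (φ : D.carrier → D.carrier)
    (hφ : BlochWCO.IsHolomorphic (fun z => (φ z : BlochWCO.Cn n)))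
    (hψ : ψ ∈ BlochWCO.hInfSubmodule D μ)
    (hlim : Tendsto
      (fun z : D.carrier => ENNReal.ofReal (1 / 2 * μ z * ‖ψ z‖) * BlochWCO.omega D (φ z))
      (comap (fun z : D.carrier => (φ z : BlochWCO.Cn n)) (𝓝ˢ (frontier D.carrier))) (𝓝 0)) :
    ∃ W : BlochWCO.BlochSpace D →L[ℂ] BlochWCO.HInf D μ,
      (∀ (f : BlochWCO.BlochSpace D) (z : D.carrier), W f z = ψ z * f (φ z)) ∧
      IsCompactOperator W := by
  have : Nonempty D.carrier := ⟨⟨0, D.zero_mem⟩⟩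
  obtain ⟨M, hM⟩ := hψ.2
  replace hM : ∀ z, μ z * ‖ψ z‖ ≤ M := fun z => hM ⟨z, rfl⟩
  have hμψ : ∀ z, 0 ≤ μ z * ‖ψ z‖ := fun z => mul_nonneg (μ.pos z).le (norm_nonneg _)
  have hM0 : 0 ≤ M := (hμψ ⟨0, D.zero_mem⟩).trans (hM _)
  have hsplit : ∀ (f : BlochSpace D) (z : D.carrier),
      μ z * ‖ψ z * f (φ z)‖ = μ z * ‖ψ z‖ * ‖zeroExt f.toFun (φ z)‖ := by
    intro f z
    rw [zeroExt_apply, norm_mul, mul_assoc]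
  obtain ⟨W, hW⟩ : ∃ W : BlochSpace D →L[ℂ] HInf D μ,
      ∀ (f : BlochSpace D) (z : D.carrier), W f z = ψ z * f (φ z) := by
    -- For boundedness `ε = 1` is enough: `M * C` comes from `φ z ∈ S` and `M + 1` from its
    -- complement.
    obtain ⟨S, hS, hSD, hSz⟩ := exists_isCompact_weighted_le hlim one_pos
    obtain ⟨C, hC0, hC⟩ := BlochSpace.exists_norm_le_of_isCompact hS hSD
    refine exists_weightedComposition hφ hψ (C := M * C + (M + 1)) fun f z => ?_
    have hf := norm_nonneg f
    by_cases hz : (φ z : Cn n) ∈ S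
    · calc _ ≤ M * (C * ‖f‖) := by
            rw [hsplit]
            exact mul_le_mul (hM z) (hC f _ hz) (norm_nonneg _) hM0
        _ ≤ M * (C * ‖f‖) + (M + 1) * ‖f‖ := le_add_of_nonneg_right (by positivity)
        _ = _ := by ring
    · calc _ ≤ M * ‖f‖ + 1 * ‖f‖ := (hSz z hz f).trans (add_le_add_left
            (mul_le_mul (hM z) f.norm_apply_zero_le (norm_nonneg _) hM0) _)
        _ ≤ M * C * ‖f‖ + (M * ‖f‖ + 1 * ‖f‖) := le_add_of_nonneg_left (by positivity)
        _ = _ := by ring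
  refine ⟨W, hW, W '' Metric.closedBall 0 1, ?_, ?_⟩
  · refine isCompact_iff_ultrafilter_le_nhds.2 fun l hl => ?_
    obtain ⟨l', hl', rfl⟩ : ∃ l' : Ultrafilter (BlochSpace D),
        Metric.closedBall 0 1 ∈ l' ∧ l'.map W = l := by
      -- An ultrafilter on the image lifts to one on the ball, where pointwise limits exist.
      have h := le_principal_iff.1 hl
      exact ⟨Ultrafilter.ofComapInfPrincipal h, Ultrafilter.ofComapInfPrincipal_mem h,
        Ultrafilter.ofComapInfPrincipal_eq_of_map h⟩
    have hball : ∀ᶠ f in (l' : Filter (BlochSpace D)), ‖f‖ ≤ 1 := by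
      filter_upwards [hl'] with f hf
      simpa using hf
    obtain ⟨g, hg1, hg⟩ := BlochSpace.exists_tendsto_apply l' hball
    refine ⟨W g, ⟨g, by simpa using hg1, rfl⟩, ?_⟩
    change Tendsto W l' (𝓝 (W g))
    rw [Metric.tendsto_nhds]
    intro ε hε
    -- Since `‖f - g‖ ≤ 2`, the tail costs `ε / 4`; the values on `S` and at `0` cost at most `ε /
    -- 4` each. Either case stays within `ε / 2`, which leaves room for a strict inequality after
    -- the supremum.
    obtain ⟨S, hS, hSD, hSz⟩ := exists_isCompact_weighted_le hlim (ε := ε / 8) (by positivity)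
    have hδ : 0 < ε / (4 * (M + 1)) := by positivity
    have hMδ : M * (ε / (4 * (M + 1))) ≤ ε / 4 := by
      calc _ ≤ (M + 1) * (ε / (4 * (M + 1))) := by gcongr; linarith
        _ = ε / 4 := by field_simp
    filter_upwards [hball, BlochSpace.eventually_norm_sub_le hball hg1 hg hS hSD hδ,
      BlochSpace.eventually_norm_sub_le hball hg1 hg isCompact_singleton
        (Set.singleton_subset_iff.2 D.zero_mem) hδ] with f hf hfS hf0
    have hsub : ∀ z, zeroExt (f - g).toFun z = zeroExt f.toFun z - zeroExt g.toFun z := by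
      intro z
      rw [sub_eq_add_neg, ← neg_one_smul ℂ g, BlochSpace.toFun_add, BlochSpace.toFun_smul,
        zeroExt_add, zeroExt_smul]
      simp [sub_eq_add_neg]
    rw [dist_eq_norm, ← map_sub]
    refine lt_of_le_of_lt (b := ε / 2) (ciSup_le fun z => ?_) (by linarith)
    rw [hW]
    by_cases hz : (φ z : Cn n) ∈ S
    · rw [hsplit, hsub]
      have := mul_le_mul (hM z) (hfS _ hz) (norm_nonneg _) hM0
      linarith
    · have h1 := hSz z hz (f - g)
      have h2 : ‖(f - g) ⟨0, D.zero_mem⟩‖ ≤ ε / (4 * (M + 1)) := by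
        rw [← zeroExt_apply (f - g).toFun, hsub]
        exact hf0 0 rfl
      have h3 := mul_le_mul (hM z) h2 (norm_nonneg _) hM0
      have h4 : ε / 8 * ‖f - g‖ ≤ ε / 8 * 2 := by
        gcongr
        linarith [norm_sub_le f g]
      linarith
  · filter_upwards [Metric.closedBall_mem_nhds (0 : BlochSpace D) one_pos] with f hf
    exact ⟨f, hf, rfl⟩
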